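/- Let $G=(V,E)$ be a finite simple graph on $n$ vertices. A configuration is a set $S\subseteq V$ (of vertices carrying tokens). Two configurations $S,S'$ are adjacent if $S'=(S\cup\{y\})\setminus\{x\}$ for some $x\in S$, $y\in V\setminus S$ with $xy\in E$. A configuration $T$ is reachable from $S$ in $\ell$ steps if there is a sequence $S=S_0,S_1,\dots,S_\ell=T$ of configurations in which consecutive ones are adjacent. Given a graph $G$, a configuration $S$ and an integer $b\ge 0$, Independent Set Discovery (IS-D) asks whether some independent set $T$ of $G$ is reachable from $S$ in at most $b$ steps, and Feedback Vertex Set Discovery (FVS-D) asks the same for a feedback vertex set $T$ of $G$, that is, a set of vertices meeting every cycle of $G$. A split graph is a graph whose vertex set can be partitioned into a clique and an independent set (either may be empty). Both IS-D and FVS-D can be solved in polynomial time on split graphs: for each of the two problems there are an algorithm (a random access machine program with unit-cost addition, truncated subtraction, comparison with zero and array access) and a polynomial $p$ such that, for every split graph $G$ on $n$ vertices (given by its adjacency matrix), every configuration $S$ and every $b\ge 0$, the algorithm halts on $(G,S,b)$ after at most $p(n)$ steps with the correct answer. -/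

import Mathlib

namespace Discovery

section Graphs

variable {V : Type*}

/-- A split graph: the vertex set is partitioned into a clique `Q` and an independent set `Qᶜ`
(either part may be empty). -/
def IsSplit (G : SimpleGraph V) : Prop :=
  ∃ Q : Set V, G.IsClique Q ∧ G.IsIndepSet Qᶜ

/-- A feedback vertex set: a set of vertices that meets every cycle. -/
def IsFeedbackVertexSet (G : SimpleGraph V) (F : Set V) : Prop :=
  ∀ (v : V) (c : G.Walk v v), c.IsCycle → ∃ x ∈ c.support, x ∈ F

variable [DecidableEq V]

/-- Two configurations are adjacent if one token of the first slides along an edge to an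
unoccupied vertex. -/
def ConfigAdj (G : SimpleGraph V) (S S' : Finset V) : Prop :=
  ∃ x ∈ S, ∃ y ∉ S, G.Adj x y ∧ S' = (S ∪ {y}) \ {x}

/-- `T` is reachable from `S` in exactly `l` steps. -/
def ReachableIn (G : SimpleGraph V) (l : ℕ) (S T : Finset V) : Prop :=
  ∃ C : ℕ → Finset V, C 0 = S ∧ C l = T ∧ ∀ i < l, ConfigAdj G (C i) (C (i + 1))

/-- The question asked by Independent Set Discovery on the instance `(G, S, b)`. -/
def ISD (G : SimpleGraph V) (S : Finset V) (b : ℕ) : Prop :=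
  ∃ T : Finset V, G.IsIndepSet (T : Set V) ∧ ∃ l ≤ b, ReachableIn G l S T

/-- The question asked by Feedback Vertex Set Discovery on the instance `(G, S, b)`. -/
def FVSD (G : SimpleGraph V) (S : Finset V) (b : ℕ) : Prop :=
  ∃ T : Finset V, IsFeedbackVertexSet G (T : Set V) ∧ ∃ l ≤ b, ReachableIn G l S T

end Graphs

section Machine

/-! A random access machine with structured control flow, at unit cost. It has registers
`x₀, x₁, …` and (two-dimensional) arrays `A₀, A₁, …` of natural numbers; a program is a finite
object, so it names only finitely many of them, while array cells are addressed by computed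
values. The only arithmetic is addition and truncated subtraction (no multiplication), so that
`t` steps lengthen the numbers by only `O(t)` bits and polynomial time on this machine
is polynomial time on Turing machines. -/

/-- The contents of the registers and of the arrays. -/
structure State where
  reg : ℕ → ℕ
  mem : ℕ → ℕ → ℕ → ℕ

/-- Expressions: constants, registers, array cells `A_a[i][j]`, sums, truncated differences. -/
inductive Expr where
  | const (c : ℕ)
  | var (x : ℕ)
  | get (a : ℕ) (i j : Expr)
  | add (e f : Expr)
  | sub (e f : Expr)

/-- The value of an expression. -/
def Expr.eval (s : State) : Expr → ℕ
  | .const c => c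
  | .var x => s.reg x
  | .get a i j => s.mem a (i.eval s) (j.eval s)
  | .add e f => e.eval s + f.eval s
  | .sub e f => e.eval s - f.eval s

/-- The number of steps taken to evaluate an expression: one for each operation in it. -/
def Expr.cost : Expr → ℕ
  | .const _ => 1
  | .var _ => 1
  | .get _ i j => i.cost + j.cost + 1
  | .add e f => e.cost + f.cost + 1
  | .sub e f => e.cost + f.cost + 1

/-- Programs: assignment to a register, to an array cell `A_a[i][j]`, sequential composition,
branching (on `e ≠ 0`) and loops (while `e ≠ 0`). -/
inductive Program where
  | skip
  | assign (x : ℕ) (e : Expr)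
  | put (a : ℕ) (i j e : Expr)
  | seq (p q : Program)
  | ite (e : Expr) (p q : Program)
  | loop (e : Expr) (p : Program)

/-- The state after the register `x` has received the value `v`. -/
def State.setReg (s : State) (x v : ℕ) : State where
  reg := Function.update s.reg x v
  mem := s.mem

/-- The state after the array cell `A_a[i][j]` has received the value `v`. -/
def State.setMem (s : State) (a i j v : ℕ) : State where
  reg := s.reg
  mem := fun a' i' j' => if a' = a ∧ i' = i ∧ j' = j then v else s.mem a' i' j'

/-- `Exec p s t s'`: started in the state `s`, the program `p` halts after exactly `t` steps,
in the state `s'`. -/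
inductive Exec : Program → State → ℕ → State → Prop where
  | skip (s : State) : Exec .skip s 1 s
  | assign (x : ℕ) (e : Expr) (s : State) :
      Exec (.assign x e) s (e.cost + 1) (s.setReg x (e.eval s))
  | put (a : ℕ) (i j e : Expr) (s : State) :
      Exec (.put a i j e) s (i.cost + j.cost + e.cost + 1)
        (s.setMem a (i.eval s) (j.eval s) (e.eval s))
  | seq {p q : Program} {s s₁ s₂ : State} {t₁ t₂ : ℕ} :
      Exec p s t₁ s₁ → Exec q s₁ t₂ s₂ → Exec (.seq p q) s (t₁ + t₂) s₂
  | ite_true {e : Expr} {p q : Program} {s s₁ : State} {t : ℕ} :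
      e.eval s ≠ 0 → Exec p s t s₁ → Exec (.ite e p q) s (e.cost + 1 + t) s₁
  | ite_false {e : Expr} {p q : Program} {s s₁ : State} {t : ℕ} :
      e.eval s = 0 → Exec q s t s₁ → Exec (.ite e p q) s (e.cost + 1 + t) s₁
  | loop_true {e : Expr} {p : Program} {s s₁ s₂ : State} {t₁ t₂ : ℕ} :
      e.eval s ≠ 0 → Exec p s t₁ s₁ → Exec (.loop e p) s₁ t₂ s₂ →
        Exec (.loop e p) s (e.cost + 1 + t₁ + t₂) s₂
  | loop_false {e : Expr} {p : Program} {s : State} :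
      e.eval s = 0 → Exec (.loop e p) s (e.cost + 1) s

open Classical in
/-- The initial state for the instance `(G, S, b)`: `x₀ = n` is the number of vertices, `x₁ = b`,
`A₀` is the adjacency matrix of `G`, and `A₁[v][0]` tells whether `v` belongs to `S`; every other
register and cell is `0`. -/
noncomputable def input {n : ℕ} (G : SimpleGraph (Fin n)) (S : Finset (Fin n)) (b : ℕ) :
    State where
  reg := fun x => if x = 0 then n else if x = 1 then b else 0
  mem := fun a i j =>
    if a = 0 then
      if ∃ (hi : i < n) (hj : j < n), G.Adj ⟨i, hi⟩ ⟨j, hj⟩ then 1 else 0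
    else if a = 1 then
      if j = 0 ∧ ∃ hi : i < n, (⟨i, hi⟩ : Fin n) ∈ S then 1 else 0
    else 0

/-- The decision problem `Q` can be solved in polynomial time on the graphs in the class `C`: one
program halts on every instance `(G, S, b)` with `G` in `C`, after a number of steps that is at
most polynomial in the number of vertices, with the answer (`1` for yes, `0` for no) in `x₀`. -/
def SolvableInPolyTimeOn (C : ∀ n : ℕ, SimpleGraph (Fin n) → Prop)
    (Q : ∀ n : ℕ, SimpleGraph (Fin n) → Finset (Fin n) → ℕ → Prop) : Prop :=
  ∃ (P : Program) (p : Polynomial ℕ),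
    ∀ (n : ℕ) (G : SimpleGraph (Fin n)) (S : Finset (Fin n)) (b : ℕ), C n G →
      ∃ (t : ℕ) (s : State), Exec P (input G S b) t s ∧ t ≤ p.eval n ∧
        (Q n G S b → s.reg 0 = 1) ∧ (¬ Q n G S b → s.reg 0 = 0)

end Machine

end Discovery

namespace Discovery

/-! Tokens are indistinguishable, so sliding them is an assignment problem. A configuration
containing `M` can be reached from `S` in at most `b` steps exactly when the vertices of `M` can be
matched injectively to tokens of `S` along walks of total length at most `b`
(`exists_superset_reachableIn_iff`): a token that blocks a walk simply takes over the rest of it.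
Slides are reversible, which gives the analogous criterion for ending inside a set `X`
(`exists_subset_reachableIn_iff`).

Split graphs leave only polynomially many targets. Every independent set lies in a maximal
independent side of a split partition or in the set of non-neighbours of a clique vertex, and all
these sets have the form `cand G t k` (`exists_indep_cand_superset`). A feedback vertex set misses
at most two clique vertices `u`, `v`, by triangles, and must contain all their common neighbours;
conversely these conditions suffice (`IsFeedbackVertexSet.exists_forced_subset`,
`isFeedbackVertexSet_of_forced_subset`). So each problem is a disjunction over quadruples `t, k, u,
v` of assignment problems (`isd_iff`, `fvsd_iff`).

Each assignment problem is padded to a search for a cheap permutation (`cover_iff_exists_perm`).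
Distances are below `n`, so the budget can be capped at `n * n` and forbidden pairs priced at `n * n
+ 1`; no running time depends on `b`. The permutation comes from an auction with bid increment 1,
which is optimal up to `n` (`Auction.exists_perm`). Multiplying all costs by `n + 1` makes this
error harmless (`decideCmd_den`). Every bid raises the total price by 1 and prices are bounded, so
`(n + 1) ^ 4` rounds suffice (`roundsCmd_den`).

The algorithm is written in a language whose loops run `n + c` times. Halting and a polynomial time
bound then follow by structural induction (`Cmd.exec`), and correctness concerns only the function
`Cmd.den`. -/

@[simp] theorem State.setReg_reg (s : State) (x v y : ℕ) :
    (s.setReg x v).reg y = if y = x then v else s.reg y := by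
  simp [State.setReg, Function.update_apply]

@[simp] theorem State.setReg_mem (s : State) (x v : ℕ) : (s.setReg x v).mem = s.mem := rfl

@[simp] theorem State.setMem_reg (s : State) (a i j v : ℕ) : (s.setMem a i j v).reg = s.reg := rfl

@[simp] theorem State.setMem_mem (s : State) (a i j v a' i' j' : ℕ) :
    (s.setMem a i j v).mem a' i' j' = if a' = a ∧ i' = i ∧ j' = j then v else s.mem a' i' j' := rfl

/-! ### A language of counted loops: semantics, running time, invariants. -/

/-- Programs whose only loops are counted: `forn x c p` runs `p` with `x` ranging over the numbers
below `n + c`, where `n` is the content of register `0`. -/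
inductive Cmd where
  | skip
  | assign (x : ℕ) (e : Expr)
  | put (a : ℕ) (i j e : Expr)
  | seq (p q : Cmd)
  | ite (e : Expr) (p q : Cmd)
  | forn (x c : ℕ) (p : Cmd)

namespace Cmd

/-- The machine program of a command. -/
def compile : Cmd → Program
  | skip => .skip
  | assign x e => .assign x e
  | put a i j e => .put a i j e
  | seq p q => .seq p.compile q.compile
  | ite e p q => .ite e p.compile q.compile
  | forn x c p => .seq (.assign x (.const 0))
      (.loop (.sub (.add (.var 0) (.const c)) (.var x))
        (.seq p.compile (.assign x (.add (.var x) (.const 1)))))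

/-- The state transformation effected by a command. -/
def den : Cmd → State → State
  | skip, s => s
  | assign x e, s => s.setReg x (e.eval s)
  | put a i j e, s => s.setMem a (i.eval s) (j.eval s) (e.eval s)
  | seq p q, s => q.den (p.den s)
  | ite e p q, s => if e.eval s ≠ 0 then p.den s else q.den s
  | forn x c p, s =>
      (fun s => (p.den s).setReg x (s.reg x + 1))^[s.reg 0 + c] (s.setReg x 0)

/-- Whether a command may write to the register `x`. -/
def writesReg (x : ℕ) : Cmd → Bool
  | skip => false
  | assign y _ => x == y
  | put _ _ _ _ => false
  | seq p q => p.writesReg x || q.writesReg x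
  | ite _ p q => p.writesReg x || q.writesReg x
  | forn y _ p => x == y || p.writesReg x

/-- Whether a command may write to the array `a`. -/
def writesMem (a : ℕ) : Cmd → Bool
  | skip => false
  | assign _ _ => false
  | put b _ _ _ => a == b
  | seq p q => p.writesMem a || q.writesMem a
  | ite _ p q => p.writesMem a || q.writesMem a
  | forn _ _ p => p.writesMem a

/-- No loop writes to its counter or to register `0`. -/
def wf : Cmd → Bool
  | skip => true
  | assign _ _ => true
  | put _ _ _ _ => true
  | seq p q => p.wf && q.wf
  | ite _ p q => p.wf && q.wf
  | forn x _ p => x != 0 && !p.writesReg x && !p.writesReg 0 && p.wf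

/-- A bound for the running time. -/
noncomputable def time : Cmd → Polynomial ℕ
  | skip => .C 1
  | assign _ e => .C (e.cost + 1)
  | put _ i j e => .C (i.cost + j.cost + e.cost + 1)
  | seq p q => p.time + q.time
  | ite e p q => .C (e.cost + 1) + p.time + q.time
  | forn _ c p => .C 8 + (.X + .C c) * (p.time + .C 10)

theorem den_reg {x : ℕ} (p : Cmd) (h : p.writesReg x = false) (s : State) :
    (p.den s).reg x = s.reg x := by
  induction p generalizing s with
  | skip => rfl
  | assign y e => simp_all [writesReg, den]
  | put => rfl
  | seq p q hp hq => simp_all [writesReg, den]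
  | ite e p q hp hq =>
    simp only [writesReg, Bool.or_eq_false_iff] at h
    simp only [den]
    split_ifs
    · exact hp h.1 s
    · exact hq h.2 s
  | forn y c p hp =>
    simp only [writesReg, Bool.or_eq_false_iff, beq_eq_false_iff_ne] at h
    simp only [den]
    generalize s.reg 0 + c = m
    induction m with
    | zero => simp [h.1]
    | succ m ih => rw [Function.iterate_succ_apply']; simp [h.1, hp h.2, ih]

theorem den_mem {a : ℕ} (p : Cmd) (h : p.writesMem a = false) (s : State) :
    (p.den s).mem a = s.mem a := by
  induction p generalizing s with
  | skip => rfl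
  | assign y e => rfl
  | put b i j e =>
    simp only [writesMem, beq_eq_false_iff_ne] at h
    funext i' j'
    simp [den, h]
  | seq p q hp hq => simp_all [writesMem, den]
  | ite e p q hp hq =>
    simp only [writesMem, Bool.or_eq_false_iff] at h
    simp only [den]
    split_ifs
    · exact hp h.1 s
    · exact hq h.2 s
  | forn y c p hp =>
    simp only [writesMem] at h
    simp only [den]
    generalize s.reg 0 + c = m
    induction m with
    | zero => rfl
    | succ m ih => rw [Function.iterate_succ_apply']; simp [hp h, ih]

/-- Since register `0` is never written, it holds the same `n` throughout the run, so every loop has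
the trip count `n + c` and the bounds compose as polynomials in `n`. -/
theorem exec (p : Cmd) (hwf : p.wf = true) (hp0 : p.writesReg 0 = false) (s : State) :
    ∃ t ≤ p.time.eval (s.reg 0), Exec p.compile s t (p.den s) := by
  obtain ⟨n, hn⟩ : ∃ n, s.reg 0 = n := ⟨_, rfl⟩
  rw [hn]
  induction p generalizing s with
  | skip => exact ⟨_, by simp [time], .skip s⟩
  | assign x e => exact ⟨_, by simp [time], .assign x e s⟩
  | put a i j e => exact ⟨_, by simp [time], .put a i j e s⟩
  | seq p q hp hq =>
    simp only [wf, Bool.and_eq_true, writesReg, Bool.or_eq_false_iff] at hwf hp0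
    obtain ⟨t₁, h₁, e₁⟩ := hp hwf.1 hp0.1 s hn
    obtain ⟨t₂, h₂, e₂⟩ := hq hwf.2 hp0.2 (p.den s) (by rw [den_reg p hp0.1, hn])
    exact ⟨t₁ + t₂, by simp only [time, Polynomial.eval_add]; omega, .seq e₁ e₂⟩
  | ite e p q hp hq =>
    simp only [wf, Bool.and_eq_true, writesReg, Bool.or_eq_false_iff] at hwf hp0
    obtain ⟨t₁, h₁, e₁⟩ := hp hwf.1 hp0.1 s hn
    obtain ⟨t₂, h₂, e₂⟩ := hq hwf.2 hp0.2 s hn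
    by_cases he : e.eval s = 0
    · refine ⟨e.cost + 1 + t₂, ?_, ?_⟩
      · simp only [time, Polynomial.eval_add, Polynomial.eval_C]; omega
      · simpa [den, compile, he] using Exec.ite_false he e₂
    · refine ⟨e.cost + 1 + t₁, ?_, ?_⟩
      · simp only [time, Polynomial.eval_add, Polynomial.eval_C]; omega
      · simpa [den, compile, he] using Exec.ite_true he e₁
  | forn x c p hp =>
    simp only [wf, Bool.and_eq_true, Bool.not_eq_true', bne_iff_ne] at hwf
    obtain ⟨⟨⟨hx, hpx⟩, hp0'⟩, hpwf⟩ := hwf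
    -- The guard costs 6 per test and the increment 4, whence 10 per iteration; the leading 6 pays
    -- for the final failing test.
    have key : ∀ m s, s.reg 0 = n → s.reg x + m = n + c →
        ∃ t ≤ 6 + m * (p.time.eval n + 10),
          Exec (.loop (.sub (.add (.var 0) (.const c)) (.var x))
            (.seq p.compile (.assign x (.add (.var x) (.const 1))))) s t
            ((fun s => (p.den s).setReg x (s.reg x + 1))^[m] s) := by
      intro m
      induction m with
      | zero =>
        intro s hs hm
        exact ⟨6, by simp, .loop_false (by simp [Expr.eval]; omega)⟩
      | succ m ih =>
        intro s hs hm
        obtain ⟨t₁, h₁, e₁⟩ := hp hpwf hp0' s hs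
        obtain ⟨t₂, h₂, e₂⟩ := ih ((p.den s).setReg x (s.reg x + 1))
          (by simp [Ne.symm hx, den_reg p hp0', hs]) (by simp; omega)
        refine ⟨6 + (t₁ + 4) + t₂, by rw [Nat.succ_mul]; omega, ?_⟩
        rw [Function.iterate_succ_apply]
        refine .loop_true (by simp [Expr.eval]; omega) (.seq e₁ ?_) e₂
        -- The machine increments the counter as left by the body, the denotation as found before
        -- it; they agree because the body does not write to `x`.
        have := Exec.assign x (.add (.var x) (.const 1)) (p.den s)
        simpa [Expr.eval, Expr.cost, den_reg p hpx] using this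
    obtain ⟨t, ht, e⟩ := key (n + c) (s.setReg x 0) (by simp [Ne.symm hx, hn]) (by simp)
    refine ⟨2 + t, ?_, ?_⟩
    · simp only [time, Polynomial.eval_add, Polynomial.eval_mul, Polynomial.eval_C,
        Polynomial.eval_X]
      omega
    · simp only [den, hn]
      exact .seq (.assign x (.const 0) s) e

/-- The state `s'` differs from `s` only in places to which `p` may write. -/
def Frame (p : Cmd) (s s' : State) : Prop :=
  (∀ y, p.writesReg y = false → s'.reg y = s.reg y) ∧
    ∀ a, p.writesMem a = false → s'.mem a = s.mem a

/-- The induction principle for counted loops. -/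
theorem forn_induction {x c : ℕ} {p : Cmd} {s : State} (I : ℕ → State → Prop) {n : ℕ}
    (hwf : (forn x c p).wf = true) (hn : s.reg 0 = n) (h0 : I 0 (s.setReg x 0))
    (hs : ∀ k s', k < n + c → s'.reg x = k → Frame (forn x c p) s s' → I k s' →
      I (k + 1) ((p.den s').setReg x (k + 1))) :
    I (n + c) ((forn x c p).den s) := by
  simp only [wf, Bool.and_eq_true, Bool.not_eq_true', bne_iff_ne] at hwf
  obtain ⟨⟨⟨hx, hpx⟩, hp0⟩, -⟩ := hwf
  have key : ∀ m ≤ n + c,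
      I m ((fun s => (p.den s).setReg x (s.reg x + 1))^[m] (s.setReg x 0)) ∧
      Frame (forn x c p) s ((fun s => (p.den s).setReg x (s.reg x + 1))^[m] (s.setReg x 0)) ∧
      ((fun s => (p.den s).setReg x (s.reg x + 1))^[m] (s.setReg x 0)).reg x = m := by
    intro m
    induction m with
    | zero =>
      refine fun _ => ⟨h0, ⟨fun y hy => ?_, fun a _ => rfl⟩, by simp⟩
      simp only [writesReg, Bool.or_eq_false_iff, beq_eq_false_iff_ne] at hy
      simp [hy.1]
    | succ m ih =>
      intro hm
      obtain ⟨h1, h2, h3⟩ := ih (by omega)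
      rw [Function.iterate_succ_apply', h3]
      refine ⟨hs m _ (by omega) h3 h2 h1, ⟨fun y hy => ?_, fun a ha => ?_⟩, by simp⟩
      · have := h2.1 y hy
        simp only [writesReg, Bool.or_eq_false_iff, beq_eq_false_iff_ne] at hy
        simpa [hy.1, den_reg p hy.2] using this
      · have := h2.2 a ha
        simp only [writesMem] at ha
        simpa [den_mem p ha] using this
  simp only [den, hn]
  exact (key _ le_rfl).1

/-- Summation of an expression into a register. -/
def sumLoop (acc x c : ℕ) (e : Expr) : Cmd := forn x c (assign acc (.add (.var acc) e))

theorem sumLoop_wf {acc x c : ℕ} {e : Expr} (hx : x ≠ 0) (ha : acc ≠ 0) (hxa : x ≠ acc) :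
    (sumLoop acc x c e).wf = true := by
  simp [sumLoop, wf, writesReg, hx, hxa, Ne.symm ha]

theorem sumLoop_den {acc x c n : ℕ} {e : Expr} {s : State} (f : ℕ → ℕ) (hn : s.reg 0 = n)
    (hx : x ≠ 0) (ha : acc ≠ 0) (hxa : x ≠ acc)
    (he : ∀ k < n + c, ∀ s', (∀ y, y ≠ x → y ≠ acc → s'.reg y = s.reg y) → s'.mem = s.mem →
      s'.reg x = k → e.eval s' = f k) :
    ((sumLoop acc x c e).den s).reg acc = s.reg acc + ∑ k ∈ Finset.range (n + c), f k := by
  refine forn_induction (fun k s' => s'.reg acc = s.reg acc + ∑ i ∈ Finset.range k, f i)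
    (sumLoop_wf hx ha hxa) hn (by simp [Ne.symm hxa]) ?_
  intro k s' hk hxk fr ih
  have := he k hk s' (fun y h1 h2 => fr.1 y (by simp [writesReg, h1, h2]))
    (funext fun a => fr.2 a rfl) hxk
  simp [den, Ne.symm hxa, Expr.eval, this, ih, Finset.sum_range_succ, add_assoc]

/-- Filling the first column of an array. -/
theorem forn_put_den {a x n : ℕ} {e : Expr} {s : State} (f : ℕ → ℕ) (hn : s.reg 0 = n)
    (hx : x ≠ 0)
    (he : ∀ k < n, ∀ s', (∀ y, y ≠ x → s'.reg y = s.reg y) → (∀ b, b ≠ a → s'.mem b = s.mem b) →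
      s'.reg x = k → e.eval s' = f k) :
    ∀ k < n, ((forn x 0 (put a (.var x) (.const 0) e)).den s).mem a k 0 = f k := by
  refine forn_induction (x := x) (c := 0) (p := put a (.var x) (.const 0) e)
    (fun k s' => ∀ i < k, s'.mem a i 0 = f i) (by simp [wf, writesReg, hx]) hn (by simp) ?_
  intro k s' hk hxk fr ih i hi
  have := he k hk s' (fun y h1 => fr.1 y (by simp [writesReg, h1]))
    (fun b hb => fr.2 b (by simp [writesMem, hb])) hxk
  simp only [den, State.setReg_mem, State.setMem_mem, Expr.eval, hxk, true_and, and_true, this]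
  split_ifs with h
  · rw [h]
  · exact ih i (by omega)

end Cmd
end Discovery

/-! ### Token sliding as an assignment problem. -/

namespace Discovery

section Cover

variable {V : Type*} {G : SimpleGraph V}

/-- There is a walk of length at most `k` from `x` to `y`. -/
def WalkLe (G : SimpleGraph V) (k : ℕ) (x y : V) : Prop := ∃ p : G.Walk x y, p.length ≤ k

theorem WalkLe.symm {k : ℕ} {x y : V} : WalkLe G k x y → WalkLe G k y x :=
  fun ⟨p, hp⟩ => ⟨p.reverse, by simpa using hp⟩

theorem WalkLe.trans {k l : ℕ} {x y z : V} :
    WalkLe G k x y → WalkLe G l y z → WalkLe G (k + l) x z :=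
  fun ⟨p, hp⟩ ⟨q, hq⟩ => ⟨p.append q, by simp; omega⟩

theorem WalkLe.refl (k : ℕ) (x : V) : WalkLe G k x x := ⟨.nil, by simp⟩

theorem WalkLe.mono {k l : ℕ} {x y : V} (h : k ≤ l) : WalkLe G k x y → WalkLe G l x y :=
  fun ⟨p, hp⟩ => ⟨p, hp.trans h⟩

theorem WalkLe.of_adj {x y : V} (h : G.Adj x y) : WalkLe G 1 x y := ⟨h.toWalk, by simp⟩

theorem WalkLe.succ_iff {k : ℕ} {x y : V} :
    WalkLe G (k + 1) x y ↔ x = y ∨ ∃ z, WalkLe G k x z ∧ G.Adj z y := by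
  constructor
  · rintro h
    obtain ⟨p, hp⟩ := h.symm
    cases p with
    | nil => exact .inl rfl
    | cons h p => exact .inr ⟨_, WalkLe.symm ⟨p, by simpa using hp⟩, h.symm⟩
  · rintro (rfl | ⟨z, hz, h⟩)
    · exact .refl _ _
    · exact hz.trans (.of_adj h)

/-- A walk leaving a set uses an edge that leaves it. -/
theorem WalkLe.exists_boundary {S : Set V} {k : ℕ} {x y : V} (h : WalkLe G k x y) (hx : x ∈ S)
    (hy : y ∉ S) : ∃ u ∈ S, ∃ v ∉ S, G.Adj u v ∧ ∃ i j, i + 1 + j ≤ k ∧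
      WalkLe G i x u ∧ WalkLe G j v y := by
  obtain ⟨p, hp⟩ := h
  induction p generalizing k with
  | nil => exact absurd hx hy
  | @cons a c d h p ih =>
    simp only [SimpleGraph.Walk.length_cons] at hp
    by_cases hc : c ∈ S
    · obtain ⟨u, hu, v, hv, huv, i, j, hij, h1, h2⟩ := ih hc hy (k := k - 1) (by omega)
      exact ⟨u, hu, v, hv, huv, 1 + i, j, by omega, (WalkLe.of_adj h).trans h1, h2⟩
    · exact ⟨a, hx, c, hc, h, 0, p.length, by omega, .refl _ _, ⟨p, le_rfl⟩⟩

/-- The vertices of `M` can be assigned distinct vertices of `S` along walks of total length at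
most `m`. -/
def Cover (G : SimpleGraph V) (S M : Finset V) (m : ℕ) : Prop :=
  ∃ (g : V → V) (k : V → ℕ), (∀ t ∈ M, g t ∈ S) ∧ Set.InjOn g M ∧
    (∀ t ∈ M, WalkLe G (k t) (g t) t) ∧ ∑ t ∈ M, k t ≤ m

variable [DecidableEq V]

theorem ConfigAdj.symm {S T : Finset V} (h : ConfigAdj G S T) : ConfigAdj G T S := by
  obtain ⟨x, hx, y, hy, hxy, rfl⟩ := h
  have hne : x ≠ y := hxy.ne
  refine ⟨y, by simp [hne.symm], x, by simp, hxy.symm, ?_⟩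
  ext z
  simp only [Finset.mem_sdiff, Finset.mem_union, Finset.mem_singleton]
  by_cases h1 : z = x <;> by_cases h2 : z = y <;> simp_all

theorem ConfigAdj.card_eq {S T : Finset V} (h : ConfigAdj G S T) : T.card = S.card := by
  obtain ⟨x, hx, y, hy, hxy, rfl⟩ := h
  rw [Finset.card_sdiff_of_subset (by simp [hx]), Finset.union_comm,
    ← Finset.insert_eq, Finset.card_insert_of_notMem hy]
  simp

theorem ReachableIn.symm {l : ℕ} {S T : Finset V} (h : ReachableIn G l S T) :
    ReachableIn G l T S := by
  obtain ⟨C, h0, hl, hC⟩ := h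
  refine ⟨fun i => C (l - i), by simpa using hl, by simpa using h0, fun i hi => ?_⟩
  have := (hC (l - (i + 1)) (by omega)).symm
  rwa [show l - (i + 1) + 1 = l - i by omega] at this

theorem ReachableIn.succ_iff {l : ℕ} {S T : Finset V} :
    ReachableIn G (l + 1) S T ↔ ∃ S', ReachableIn G l S S' ∧ ConfigAdj G S' T := by
  constructor
  · rintro ⟨C, h0, hl, hC⟩
    exact ⟨C l, ⟨C, h0, rfl, fun i hi => hC i (by omega)⟩, hl ▸ hC l (by omega)⟩
  · rintro ⟨S', ⟨C, h0, hl, hC⟩, h⟩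
    refine ⟨fun i => if i ≤ l then C i else T, by simpa using h0, by simp, fun i hi => ?_⟩
    rcases Nat.lt_succ_iff_lt_or_eq.1 hi with hi | rfl
    · simpa [hi.le, Nat.succ_le_of_lt hi] using hC i hi
    · simpa [hl] using h

theorem ReachableIn.cons {l : ℕ} {S S' T : Finset V} (h : ConfigAdj G S S')
    (hl : ReachableIn G l S' T) : ReachableIn G (l + 1) S T :=
  (ReachableIn.succ_iff.2 ⟨_, hl.symm, h.symm⟩).symm

theorem ReachableIn.card_eq {l : ℕ} {S T : Finset V} (h : ReachableIn G l S T) :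
    T.card = S.card := by
  induction l generalizing T with
  | zero => obtain ⟨C, rfl, rfl, -⟩ := h; rfl
  | succ l ih =>
    obtain ⟨S', h1, h2⟩ := ReachableIn.succ_iff.1 h
    rw [h2.card_eq, ih h1]

/-- Follow each token: a final slide from `x` to `y` prolongs by one edge the route of the token
that stood on `x`, and leaves all other routes alone. -/
theorem ReachableIn.cover {l : ℕ} {S T : Finset V} (h : ReachableIn G l S T) :
    Cover G S T l := by
  induction l generalizing T with
  | zero =>
    obtain ⟨C, rfl, rfl, -⟩ := h
    exact ⟨id, 0, by simp, Set.injOn_id _, fun t _ => .refl _ _, by simp⟩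
  | succ l ih =>
    obtain ⟨S', h1, x, hx, y, hy, hxy, rfl⟩ := ReachableIn.succ_iff.1 h
    obtain ⟨g, k, hg, hi, hk, hs⟩ := ih h1
    have hne : x ≠ y := hxy.ne
    have hmem : ∀ t ∈ (S' ∪ {y}) \ {x}, t ≠ x ∧ (t ≠ y → t ∈ S') := by
      intro t ht; simp at ht; tauto
    refine ⟨Function.update g y (g x), Function.update k y (k x + 1), ?_, ?_, ?_, ?_⟩
    · intro t ht
      by_cases h : t = y
      · simp [h, hg x hx]
      · simpa [h] using hg t ((hmem t ht).2 h)
    · intro t ht t' ht' he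
      have a := hmem t ht
      have a' := hmem t' ht'
      by_cases h : t = y <;> by_cases h' : t' = y
      · rw [h, h']
      · simp only [h, h', Function.update_self, ne_eq, not_false_eq_true,
          Function.update_of_ne] at he
        exact absurd (hi hx (a'.2 h') he).symm a'.1
      · simp only [h, h', Function.update_self, ne_eq, not_false_eq_true,
          Function.update_of_ne] at he
        exact absurd (hi (a.2 h) hx he) a.1
      · simp only [h, h', ne_eq, not_false_eq_true, Function.update_of_ne] at he
        exact hi (a.2 h) (a'.2 h') he
    · intro t ht
      by_cases h : t = y
      · subst h; simpa using (hk x hx).trans (.of_adj hxy)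
      · simpa [h] using hk t ((hmem t ht).2 h)
    · have : (S' ∪ {y}) \ {x} = insert y (S'.erase x) := by
        ext z; simp only [Finset.mem_sdiff, Finset.mem_union, Finset.mem_singleton,
          Finset.mem_insert, Finset.mem_erase]
        by_cases h : z = x <;> by_cases h' : z = y <;> simp_all
      rw [this, Finset.sum_insert (by simp [hy]),
        Finset.sum_congr rfl (g := fun t => k t) fun t ht => Function.update_of_ne
          (by rintro rfl; simp [hy] at ht) _ _]
      have := Finset.add_sum_erase S' k hx
      simp only [Function.update_self]
      omega

/-- Let `t` be an uncovered target. The walk of its token leaves `S` along some edge from `u` to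
`v`; the token on `u` makes this slide and takes over the target `t`. If it was meant for another
target `r`, the token `g t` now serves `r` by walking to `u` and continuing from there. The total
length drops by at least 1. -/
theorem Cover.exists_reachableIn {m : ℕ} {S M : Finset V} (h : Cover G S M m) :
    ∃ T, M ⊆ T ∧ ∃ l ≤ m, ReachableIn G l S T := by
  induction m using Nat.strong_induction_on generalizing S with
  | _ m ih =>
    by_cases hM : M ⊆ S
    · exact ⟨S, hM, 0, by simp, fun _ => S, rfl, rfl, by simp⟩
    obtain ⟨t, ht, htS⟩ := Finset.not_subset.1 hM
    obtain ⟨g, k, hg, hi, hk, hs⟩ := h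
    obtain ⟨u, hu, v, hv, huv, i, j, hij, h1, h2⟩ :=
      (hk t ht).exists_boundary (S := S) (hg t ht) (by simpa using htS)
    simp only [Finset.mem_coe] at hu hv
    have hvS : ∀ r ∈ M, g r ≠ v := fun r hr h => hv (h ▸ hg r hr)
    have hne : u ≠ v := huv.ne
    have hsum := Finset.add_sum_erase M k ht
    suffices H : Cover G ((S ∪ {v}) \ {u}) M (m - 1) by
      obtain ⟨T, hT, l, hl, hr⟩ := ih (m - 1) (by omega) H
      exact ⟨T, hT, l + 1, by omega, .cons ⟨u, hu, v, hv, huv, rfl⟩ hr⟩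
    refine ⟨fun r => if r = t then v else if g r = u then g t else g r,
      fun r => if r = t then j else if g r = u then i + k r else k r, ?_, ?_, ?_, ?_⟩
    · intro r hr
      have h3 := hi hr ht
      have h4 := hg r hr
      have h5 := hg t ht
      dsimp only
      split_ifs <;> simp_all [eq_comm]
    · intro r hr r' hr' he
      have a1 := hi hr ht
      have a2 := hi hr' ht
      have a3 := hi hr hr'
      have b1 := hvS r hr
      have b2 := hvS r' hr'
      have b3 := hvS t ht
      dsimp only at he
      split_ifs at he <;> simp_all
    · intro r hr
      dsimp only
      split_ifs with h3 h4
      · subst h3; exact h2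
      · exact h1.trans (h4 ▸ hk r hr)
      · exact hk r hr
    · rw [← Finset.add_sum_erase M _ ht]
      -- By injectivity at most one target was served from `u`, so the detour `i` is paid at most
      -- once.
      have : ∑ r ∈ M.erase t, (if r = t then j else if g r = u then i + k r else k r) ≤
          i + ∑ r ∈ M.erase t, k r := by
        calc _ = ∑ r ∈ M.erase t, ((if g r = u then i else 0) + k r) := by
              refine Finset.sum_congr rfl fun r hr => ?_
              rw [if_neg (Finset.ne_of_mem_erase hr)]
              split_ifs <;> simp
          _ ≤ _ := by
              rw [Finset.sum_add_distrib, ← Finset.sum_filter, Finset.sum_const, smul_eq_mul]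
              gcongr
              refine Nat.le_trans (Nat.mul_le_mul_right i ?_) (Nat.one_mul i).le
              refine Finset.card_le_one.2 fun r hr r' hr' => ?_
              simp only [Finset.mem_filter, Finset.mem_erase] at hr hr'
              exact hi hr.1.2 hr'.1.2 (hr.2.trans hr'.2.symm)
      simp only [if_true]
      omega

theorem exists_superset_reachableIn_iff {S M : Finset V} {b : ℕ} :
    (∃ T, M ⊆ T ∧ ∃ l ≤ b, ReachableIn G l S T) ↔ Cover G S M b := by
  refine ⟨?_, Cover.exists_reachableIn⟩
  rintro ⟨T, hT, l, hl, h⟩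
  obtain ⟨g, k, hg, hi, hk, hs⟩ := h.cover
  exact ⟨g, k, fun t ht => hg t (hT ht), hi.mono (by exact_mod_cast hT),
    fun t ht => hk t (hT ht), (Finset.sum_le_sum_of_subset hT).trans (hs.trans hl)⟩

/-- Reversing the slides turns the tokens of `S` into the targets. Conversely, slides from `S.image
g` reach a superset of `S` which, having at most as many vertices as `S`, is `S` itself. -/
theorem exists_subset_reachableIn_iff {S X : Finset V} {b : ℕ} :
    (∃ T, T ⊆ X ∧ ∃ l ≤ b, ReachableIn G l S T) ↔ Cover G X S b := by
  constructor
  · rintro ⟨T, hT, l, hl, h⟩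
    obtain ⟨g, k, hg, hi, hk, hs⟩ := h.symm.cover
    exact ⟨g, k, fun t ht => hT (hg t ht), hi, hk, hs.trans hl⟩
  · rintro ⟨g, k, hg, hi, hk, hs⟩
    have hc : Cover G (S.image g) S b :=
      ⟨g, k, fun t ht => Finset.mem_image_of_mem g ht, hi, hk, hs⟩
    obtain ⟨T, hT, l, hl, h⟩ := hc.exists_reachableIn
    have : S = T := Finset.eq_of_subset_of_card_le hT
      (by rw [h.card_eq]; exact Finset.card_image_le)
    subst this
    exact ⟨S.image g, Finset.image_subset_iff.2 hg, l, hl, h.symm⟩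

end Cover

end Discovery

/-! ### Independent sets and feedback vertex sets of split graphs. -/

namespace Discovery

section Split

variable {V : Type*} {G : SimpleGraph V}

/-- The independent side of a partition of a split graph may be taken to be maximal. -/
theorem IsSplit.exists_maximal (h : IsSplit G) :
    ∃ I : Set V, G.IsIndepSet I ∧ G.IsClique Iᶜ ∧ ∀ v ∉ I, ∃ w ∈ I, G.Adj v w := by
  obtain ⟨Q, hQ, hI⟩ := h
  by_cases hm : ∀ v ∉ Qᶜ, ∃ w ∈ Qᶜ, G.Adj v w
  · exact ⟨Qᶜ, hI, by simpa using hQ, hm⟩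
  push Not at hm
  obtain ⟨q, hq, hw⟩ := hm
  have hq : q ∈ Q := by simpa using hq
  -- One move is enough: every vertex remaining in the clique is adjacent to `q`.
  refine ⟨insert q Qᶜ, ?_, ?_, ?_⟩
  · intro a ha b hb hab
    rcases ha with rfl | ha <;> rcases hb with rfl | hb
    · exact absurd rfl hab
    · exact hw b hb
    · exact fun h => hw a ha h.symm
    · exact hI ha hb hab
  · refine hQ.subset ?_
    intro a ha
    by_contra h
    exact ha (.inr h)
  · intro v hv
    simp only [Set.mem_insert_iff, Set.mem_compl_iff, not_or, not_not] at hv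
    exact ⟨q, .inl rfl, hQ hv.2 hq hv.1⟩

theorem IsFeedbackVertexSet.mem_of_triangle {F : Set V} (hF : IsFeedbackVertexSet G F)
    {a b c : V} (hab : G.Adj a b) (hbc : G.Adj b c) (hca : G.Adj c a) : a ∈ F ∨ b ∈ F ∨ c ∈ F := by
  have h1 := hab.ne
  have h2 := hbc.ne
  have h3 := hca.ne
  obtain ⟨x, hx, hxF⟩ := hF a (.cons hab (.cons hbc (.cons hca .nil))) (by
    rw [SimpleGraph.Walk.cons_isCycle_iff]
    simp [SimpleGraph.Walk.isPath_def, h1, h2, h3, h1.symm, h3.symm])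
  simp at hx
  rcases hx with rfl | rfl | rfl | rfl <;> tauto

theorem walkLe_dist {x y : V} (h : G.Reachable x y) : WalkLe G (G.dist x y) x y := by
  obtain ⟨p, hl⟩ := h.exists_walk_length_eq_dist
  exact ⟨p, hl.le⟩

variable [Fintype V]

open Classical in
/-- The number of neighbours of a vertex. -/
noncomputable def deg (G : SimpleGraph V) (v : V) : ℕ := (Finset.univ.filter (G.Adj v)).card

open Classical in
/-- The vertices of degree at most `k` that are not adjacent to `t`. -/
noncomputable def cand (G : SimpleGraph V) (t : V) (k : ℕ) : Finset V :=
  Finset.univ.filter fun v => ¬ G.Adj t v ∧ deg G v ≤ k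

theorem mem_cand {t v : V} {k : ℕ} : v ∈ cand G t k ↔ ¬ G.Adj t v ∧ deg G v ≤ k := by
  simp [cand]

theorem deg_lt_card (v : V) : deg G v < Fintype.card V :=
  Finset.card_lt_univ_of_notMem (x := v) (by simp)

/-- If some `t ∈ I` sees the whole clique side, `I` is its set of non-neighbours and the degree
bound is vacuous. Otherwise degrees separate the sides: with `Q` the clique side, a vertex of `I`
misses some vertex of `Q` and has degree at most `Q.card - 1`, while a vertex of `Q` also has a
neighbour in `I` and so has degree at least `Q.card`. -/
theorem exists_eq_cand [Nonempty V] {I : Set V} (hI : G.IsIndepSet I) (hQ : G.IsClique Iᶜ)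
    (hm : ∀ v ∉ I, ∃ w ∈ I, G.Adj v w) :
    ∃ t k, k < Fintype.card V ∧ (cand G t k : Set V) = I := by
  classical
  have hindep : ∀ t ∈ I, ∀ v ∈ I, ¬ G.Adj t v := fun t ht v hv h => hI ht hv h.ne h
  by_cases hc : ∃ t ∈ I, ∀ q ∉ I, G.Adj t q
  · obtain ⟨t, ht, hq⟩ := hc
    refine ⟨t, Fintype.card V - 1, Nat.sub_lt Fintype.card_pos one_pos, ?_⟩
    ext v
    have := deg_lt_card (G := G) v
    rw [Finset.mem_coe, mem_cand]
    constructor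
    · intro h
      by_contra hv
      exact h.1 (hq v hv)
    · exact fun hv => ⟨hindep t ht v hv, by omega⟩
  · push Not at hc
    obtain ⟨t, ht⟩ : I.Nonempty := by
      obtain ⟨v⟩ := ‹Nonempty V›
      by_cases hv : v ∈ I
      · exact ⟨v, hv⟩
      · obtain ⟨w, hw, -⟩ := hm v hv
        exact ⟨w, hw⟩
    set Q : Finset V := Finset.univ.filter (· ∉ I) with hQdef
    have memQ : ∀ v, v ∈ Q ↔ v ∉ I := by simp [hQdef]
    have hle : Q.card ≤ Fintype.card V := Finset.card_le_univ _
    have hpos : 0 < Fintype.card V := Fintype.card_pos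
    refine ⟨t, Q.card - 1, by omega, ?_⟩
    ext v
    rw [Finset.mem_coe, mem_cand]
    constructor
    · rintro ⟨-, h⟩
      by_contra hv
      obtain ⟨w, hw, hvw⟩ := hm v hv
      have hvQ := (memQ v).2 hv
      have h1 : insert w (Q.erase v) ⊆ Finset.univ.filter (G.Adj v) := by
        intro z hz
        simp only [Finset.mem_insert, Finset.mem_erase, memQ] at hz
        simp only [Finset.mem_filter, Finset.mem_univ, true_and]
        rcases hz with rfl | hz
        · exact hvw
        · exact hQ hv hz.2 hz.1.symm
      have h2 := Finset.card_le_card h1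
      rw [Finset.card_insert_of_notMem (by simp [memQ, hw]), Finset.card_erase_of_mem hvQ] at h2
      have := Finset.card_pos.2 ⟨v, hvQ⟩
      have h3 : _ ≤ deg G v := h2
      omega
    · intro hv
      refine ⟨hindep t ht v hv, ?_⟩
      obtain ⟨q, hq, hvq⟩ := hc v hv
      have h1 : Finset.univ.filter (G.Adj v) ⊆ Q.erase q := by
        intro z hz
        simp only [Finset.mem_filter, Finset.mem_univ, true_and] at hz
        simp only [Finset.mem_erase, memQ]
        exact ⟨by rintro rfl; exact hvq hz, fun h => hindep v hv z h hz⟩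
      have h2 := Finset.card_le_card h1
      rwa [Finset.card_erase_of_mem ((memQ q).2 hq)] at h2

/-- If `T` is not inside `I`, it contains a clique vertex `q` and lies among the non-neighbours of
`q`. These are independent, since `q` is the only one of them outside `I`. -/
theorem exists_indep_cand_superset [Nonempty V] (hG : IsSplit G) {T : Finset V}
    (hT : G.IsIndepSet (T : Set V)) :
    ∃ t k, k < Fintype.card V ∧ G.IsIndepSet (cand G t k : Set V) ∧ T ⊆ cand G t k := by
  obtain ⟨I, hI, hQ, hm⟩ := hG.exists_maximal
  by_cases hTI : (T : Set V) ⊆ I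
  · obtain ⟨t, k, hk, he⟩ := exists_eq_cand hI hQ hm
    exact ⟨t, k, hk, he ▸ hI, by rw [← Finset.coe_subset, he]; exact hTI⟩
  obtain ⟨q, hq, hqI⟩ := Set.not_subset.1 hTI
  have hmem : ∀ v, v ∈ cand G q (Fintype.card V - 1) ↔ ¬ G.Adj q v := by
    intro v
    have := deg_lt_card (G := G) v
    rw [mem_cand]
    exact ⟨fun h => h.1, fun h => ⟨h, by omega⟩⟩
  refine ⟨q, Fintype.card V - 1, Nat.sub_lt Fintype.card_pos one_pos, ?_, ?_⟩
  · intro a ha b hb hab h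
    rw [Finset.mem_coe, hmem] at ha hb
    have key : ∀ c, ¬ G.Adj q c → c ∉ I → c = q := fun c hc hcI => by
      by_contra hne
      exact hc (hQ hqI hcI (Ne.symm hne))
    by_cases haI : a ∈ I
    · by_cases hbI : b ∈ I
      · exact hI haI hbI hab h
      · exact ha (key b hb hbI ▸ h.symm)
    · exact hb (key a ha haI ▸ h)
  · intro v hv
    rw [hmem]
    exact fun h => hT hq hv h.ne h

variable [DecidableEq V]

/-- Independent Set Discovery on split graphs, in terms of assignments. -/
theorem isd_iff [Nonempty V] (hG : IsSplit G) (S : Finset V) (b : ℕ) :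
    ISD G S b ↔ ∃ t k, k < Fintype.card V ∧ G.IsIndepSet (cand G t k : Set V) ∧
      Cover G (cand G t k) S b := by
  constructor
  · rintro ⟨T, hT, h⟩
    obtain ⟨t, k, hk, hi, hs⟩ := exists_indep_cand_superset hG hT
    exact ⟨t, k, hk, hi, exists_subset_reachableIn_iff.1 ⟨T, hs, h⟩⟩
  · rintro ⟨t, k, hk, hi, hc⟩
    obtain ⟨T, hT, h⟩ := exists_subset_reachableIn_iff.2 hc
    exact ⟨T, hi.mono (by exact_mod_cast hT), h⟩

open Classical in
/-- The complement of the forest spanned by `u`, `v` and those vertices of `X` that are not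
adjacent to both. -/
noncomputable def forced (G : SimpleGraph V) (X : Finset V) (u v : V) : Finset V :=
  Finset.univ.filter fun j => ¬ (j ∈ X ∨ j = u ∨ j = v) ∨ (u ≠ v ∧ G.Adj u j ∧ G.Adj v j)

theorem mem_forced {X : Finset V} {u v j : V} : j ∈ forced G X u v ↔
    ¬ (j ∈ X ∨ j = u ∨ j = v) ∨ (u ≠ v ∧ G.Adj u j ∧ G.Adj v j) := by
  simp [forced]

/-- A cycle avoiding `T` has at least three vertices, all in `X ∪ {u, v}`, so it passes through some
`x ∈ X` other than `u` and `v`. The two cycle neighbours of `x` are distinct and outside the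
independent set `X`, hence are `u` and `v`; but then `x` is forced. -/
theorem isFeedbackVertexSet_of_forced_subset {X T : Finset V} {u v : V}
    (hX : G.IsIndepSet (X : Set V)) (hT : forced G X u v ⊆ T) :
    IsFeedbackVertexSet G (T : Set V) := by
  intro a c hc
  by_contra hcon
  push Not at hcon
  have hin : ∀ x ∈ c.support, (x ∈ X ∨ x = u ∨ x = v) ∧ ¬ (u ≠ v ∧ G.Adj u x ∧ G.Adj v x) := by
    intro x hx
    have := fun h => hcon x hx (hT h)
    rw [mem_forced] at this
    tauto
  obtain ⟨x, hx, hxu, hxv⟩ : ∃ x ∈ c.support, x ≠ u ∧ x ≠ v := by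
    by_contra hno
    push Not at hno
    have h1 : c.support.tail.toFinset ⊆ {u, v} := by
      intro z hz
      have hz : z ∈ c.support := List.mem_of_mem_tail (List.mem_toFinset.1 hz)
      have := hno z hz
      simp only [Finset.mem_insert, Finset.mem_singleton]
      tauto
    have h2 := Finset.card_le_card h1
    rw [List.toFinset_card_of_nodup hc.support_nodup] at h2
    have h3 := hc.three_le_length
    have h4 : ({u, v} : Finset V).card ≤ 2 := Finset.card_le_two
    simp at h2
    omega
  have hxX : x ∈ X := by have := (hin x hx).1; tauto
  have hc' := hc.rotate hx
  set d := c.rotate x hx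
  have hd : ∀ y ∈ d.support, y ∈ c.support := fun y hy =>
    (SimpleGraph.Walk.mem_support_rotate_iff ..).1 hy
  have hnb : ∀ y ∈ d.support, G.Adj x y → y = u ∨ y = v := by
    intro y hy hxy
    have := (hin y (hd y hy)).1
    have : y ∉ X := fun hyX => hX hxX hyX hxy.ne hxy
    tauto
  have hn : ¬ d.Nil := hc'.not_nil
  have a1 := d.adj_snd hn
  have a2 := (d.adj_penultimate hn).symm
  have m1 := hnb _ (d.getVert_mem_support 1) a1
  have m2 := hnb _ (d.getVert_mem_support _) a2
  have hne := hc'.snd_ne_penultimate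
  change d.snd = u ∨ d.snd = v at m1
  change d.penultimate = u ∨ d.penultimate = v at m2
  apply (hin x hx).2
  rcases m1 with m1 | m1 <;> rcases m2 with m2 | m2 <;> rw [m1, m2] at hne <;>
    rw [m1] at a1 <;> rw [m2] at a2
  · exact absurd rfl hne
  · exact ⟨hne, a1.symm, a2.symm⟩
  · exact ⟨hne.symm, a2.symm, a1.symm⟩
  · exact absurd rfl hne

/-- Take for `u`, `v` two clique vertices outside `T`, if they exist: every common neighbour closes
a triangle with them and so lies in `T`. One such vertex is encoded by `u = v`; if there is none,
`T` contains the clique side and any `u = v` will do. -/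
theorem IsFeedbackVertexSet.exists_forced_subset [Nonempty V] {I T : Finset V}
    (hT : IsFeedbackVertexSet G (T : Set V)) (hQ : G.IsClique (I : Set V)ᶜ) :
    ∃ u v, forced G I u v ⊆ T := by
  by_cases h : ∃ u v, u ∉ I ∧ v ∉ I ∧ u ∉ T ∧ v ∉ T ∧ u ≠ v
  · obtain ⟨u, v, hu, hv, huT, hvT, hne⟩ := h
    have huv : G.Adj u v := hQ (by simpa using hu) (by simpa using hv) hne
    have key : ∀ j, G.Adj u j → G.Adj v j → j ∈ T := fun j h1 h2 => by
      have := hT.mem_of_triangle huv h2 h1.symm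
      simp only [Finset.mem_coe] at this
      tauto
    refine ⟨u, v, fun j hj => ?_⟩
    rcases mem_forced.1 hj with h | h
    · simp only [not_or] at h
      have hj : j ∈ (I : Set V)ᶜ := by simpa using h.1
      exact key j (hQ (by simpa using hu) hj (Ne.symm h.2.1))
        (hQ (by simpa using hv) hj (Ne.symm h.2.2))
    · exact key j h.2.1 h.2.2
  · push Not at h
    by_cases h' : ∃ u, u ∉ I ∧ u ∉ T
    · obtain ⟨u, hu, huT⟩ := h'
      refine ⟨u, u, fun j hj => ?_⟩
      rw [mem_forced] at hj
      by_contra hjT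
      have := h u j hu
      tauto
    · push Not at h'
      obtain ⟨u⟩ := ‹Nonempty V›
      refine ⟨u, u, fun j hj => h' j ?_⟩
      rw [mem_forced] at hj
      tauto

/-- Feedback Vertex Set Discovery on split graphs, in terms of assignments. -/
theorem fvsd_iff [Nonempty V] (hG : IsSplit G) (S : Finset V) (b : ℕ) :
    FVSD G S b ↔ ∃ t k, k < Fintype.card V ∧ G.IsIndepSet (cand G t k : Set V) ∧
      ∃ u v, Cover G S (forced G (cand G t k) u v) b := by
  constructor
  · rintro ⟨T, hT, h⟩
    obtain ⟨I, hI, hQ, hm⟩ := hG.exists_maximal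
    obtain ⟨t, k, hk, he⟩ := exists_eq_cand hI hQ hm
    rw [← he] at hI hQ
    obtain ⟨u, v, hs⟩ := hT.exists_forced_subset hQ
    exact ⟨t, k, hk, hI, u, v, exists_superset_reachableIn_iff.1 ⟨T, hs, h⟩⟩
  · rintro ⟨t, k, hk, hi, u, v, hc⟩
    obtain ⟨T, hT, h⟩ := exists_superset_reachableIn_iff.2 hc
    exact ⟨T, isFeedbackVertexSet_of_forced_subset hi hT, h⟩

end Split

/-! ### Assignments as permutations of bounded cost. -/

section Cost

variable {V : Type*} [Fintype V]

open Classical in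
/-- The distance of two vertices, or a number exceeding the total length of any family of `n`
paths if they lie in different components. -/
noncomputable def cappedDist (G : SimpleGraph V) (x y : V) : ℕ :=
  if G.Reachable x y then G.dist x y else Fintype.card V * Fintype.card V + 1

variable {G : SimpleGraph V}

theorem WalkLe.cappedDist_le {k : ℕ} {x y : V} (h : WalkLe G k x y) : cappedDist G x y ≤ k := by
  obtain ⟨p, hp⟩ := h
  rw [cappedDist, if_pos p.reachable]
  exact (SimpleGraph.dist_le p).trans hp

theorem dist_lt_card {x y : V} (h : G.Reachable x y) : G.dist x y < Fintype.card V := by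
  obtain ⟨p, hp, hl⟩ := h.exists_path_of_dist
  exact hl ▸ hp.length_lt

theorem WalkLe.cappedDist_lt_card {k : ℕ} {x y : V} (h : WalkLe G k x y) :
    cappedDist G x y < Fintype.card V := by
  obtain ⟨p, hp⟩ := h
  rw [cappedDist, if_pos p.reachable]
  exact dist_lt_card p.reachable

theorem walkLe_of_cappedDist_le {x y : V}
    (h : cappedDist G x y ≤ Fintype.card V * Fintype.card V) :
    WalkLe G (cappedDist G x y) x y := by
  unfold cappedDist at *
  split_ifs at * with hr
  · exact walkLe_dist hr
  · omega

open Classical in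
/-- The cost of assigning `j` to `i` if the elements of `P` need partners in `O`. -/
noncomputable def pairCost (G : SimpleGraph V) (P O : Finset V) (i j : V) : ℕ :=
  if i ∈ P then if j ∈ O then cappedDist G i j else Fintype.card V * Fintype.card V + 1 else 0

/-- Vertices outside `P` cost nothing, so the injection extends to a permutation of all vertices.
Shortest walks have fewer than `Fintype.card V` edges, so the cap on the budget loses nothing, and a
single inadmissible pair already exceeds it. -/
theorem cover_iff_exists_perm [DecidableEq V] {P O : Finset V} {b : ℕ} :
    Cover G O P b ↔ ∃ σ : Equiv.Perm V,
      ∑ i, pairCost G P O i (σ i) ≤ min b (Fintype.card V * Fintype.card V) := by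
  constructor
  · rintro ⟨g, k, hg, hi, hk, hs⟩
    obtain ⟨e, he⟩ := Set.MapsTo.exists_equiv_extend_of_card_eq (t := (Finset.univ : Finset V))
      (by simp) (s := (P : Set V)) (f := g) (by simp) hi
    refine ⟨e.trans (Equiv.subtypeUnivEquiv (by simp)), ?_⟩
    have h1 : ∀ i, pairCost G P O i (e i) ≤ if i ∈ P then k i else 0 := by
      intro i
      unfold pairCost
      split_ifs with h h'
      · rw [he i h]; exact (hk i h).symm.cappedDist_le
      · exact absurd (he i h ▸ hg i h) h'
      · exact le_rfl
    have h2 : ∀ i, pairCost G P O i (e i) ≤ Fintype.card V := by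
      intro i
      unfold pairCost
      split_ifs with h h'
      · rw [he i h]; exact (hk i h).symm.cappedDist_lt_card.le
      · exact absurd (he i h ▸ hg i h) h'
      · exact Nat.zero_le _
    refine le_min ((Finset.sum_le_sum fun i _ => h1 i).trans ?_)
      ((Finset.sum_le_sum fun i _ => h2 i).trans ?_)
    · simpa using hs
    · simp
  · rintro ⟨σ, hσ⟩
    have hle : ∀ i, pairCost G P O i (σ i) ≤ Fintype.card V * Fintype.card V := fun i =>
      (Finset.single_le_sum (f := fun i => pairCost G P O i (σ i)) (fun _ _ => Nat.zero_le _)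
        (Finset.mem_univ i)).trans (hσ.trans (min_le_right _ _))
    have hO : ∀ i ∈ P, σ i ∈ O ∧ cappedDist G i (σ i) = pairCost G P O i (σ i) := by
      intro i hi
      have := hle i
      unfold pairCost at *
      rw [if_pos hi] at *
      split_ifs at * with h
      · exact ⟨h, rfl⟩
      · omega
    refine ⟨σ, fun i => pairCost G P O i (σ i), fun i hi => (hO i hi).1, σ.injective.injOn,
      fun i hi => ?_, ?_⟩
    · dsimp only
      have := hle i
      rw [← (hO i hi).2] at this ⊢
      exact (walkLe_of_cappedDist_le this).symm
    · exact (Finset.sum_le_sum_of_subset (Finset.subset_univ P)).trans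
        (hσ.trans (min_le_left _ _))

end Cost

end Discovery

/-! ### The auction algorithm for the assignment problem. -/

namespace Discovery

/-- The invariant of an auction among the persons and objects below `n`: object `j` has price `p j`
and is held by person `o j - 1` (by nobody if `o j = 0`), prices start at `0`, and each person
holding an object is within `1` of optimality. -/
structure Auction (n C : ℕ) (c : ℕ → ℕ → ℕ) (p o : ℕ → ℕ) : Prop where
  owner_le : ∀ j < n, o j ≤ n
  owner_inj : ∀ j < n, ∀ j' < n, o j = o j' → o j ≠ 0 → j = j'
  price_free : ∀ j < n, o j = 0 → p j = 0
  slack : ∀ j < n, o j ≠ 0 → ∀ k < n, c (o j - 1) j + p j ≤ c (o j - 1) k + p k + 1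
  price_le : ∀ j < n, p j ≤ C + 1

namespace Auction

variable {n C : ℕ} {c : ℕ → ℕ → ℕ} {p o : ℕ → ℕ}

theorem start {n C : ℕ} {c : ℕ → ℕ → ℕ} : Auction n C c (fun _ => 0) (fun _ => 0) where
  owner_le := by simp
  owner_inj := by simp
  price_free := by simp
  slack := by simp
  price_le := by simp

theorem congr {p' o' : ℕ → ℕ} (h : Auction n C c p o) (hp : ∀ j < n, p' j = p j)
    (ho : ∀ j < n, o' j = o j) : Auction n C c p' o' where
  owner_le j hj := by rw [ho j hj]; exact h.owner_le j hj
  owner_inj j hj j' hj' := by rw [ho j hj, ho j' hj']; exact h.owner_inj j hj j' hj'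
  price_free j hj := by rw [ho j hj, hp j hj]; exact h.price_free j hj
  slack j hj h0 k hk := by
    rw [ho j hj] at *; rw [hp j hj, hp k hk]; exact h.slack j hj h0 k hk
  price_le j hj := by rw [hp j hj]; exact h.price_le j hj

/-- While a person holds no object, some object is free. -/
theorem exists_free (h : Auction n C c p o) {i : ℕ} (hi : i < n) (hf : ∀ j < n, o j ≠ i + 1) :
    ∃ j < n, o j = 0 := by
  by_contra hcon
  push Not at hcon
  have h1 : ((Finset.range n).image o) ⊆ (Finset.Icc 1 n).erase (i + 1) := by
    intro z hz
    obtain ⟨j, hj, rfl⟩ := Finset.mem_image.1 hz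
    have hj := Finset.mem_range.1 hj
    have := hcon j hj
    have := h.owner_le j hj
    simp only [Finset.mem_erase, Finset.mem_Icc]
    exact ⟨hf j hj, by omega, by omega⟩
  have h2 := Finset.card_le_card h1
  rw [Finset.card_image_of_injOn, Finset.card_erase_of_mem (by simp; omega)] at h2
  · simp at h2; omega
  · intro j hj j' hj' he
    simp only [Finset.coe_range, Set.mem_Iio] at hj hj'
    exact h.owner_inj j hj j' hj' he (hcon j hj)

/-- The person `i`, holding no object, bids for the best object `b`. -/
theorem bid (h : Auction n C c p o) (hC : ∀ i < n, ∀ j < n, c i j ≤ C) {i b : ℕ} (hi : i < n)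
    (hf : ∀ j < n, o j ≠ i + 1) (hb : b < n) (hmin : ∀ k < n, c i b + p b ≤ c i k + p k) :
    Auction n C c (Function.update p b (p b + 1)) (Function.update o b (i + 1)) where
  owner_le j hj := by
    by_cases hjb : j = b
    · simp [hjb]; omega
    · simpa [hjb] using h.owner_le j hj
  owner_inj j hj j' hj' he h0 := by
    by_cases h1 : j = b <;> by_cases h2 : j' = b
    · rw [h1, h2]
    · simp only [h1, h2, Function.update_self, ne_eq, not_false_eq_true,
        Function.update_of_ne] at he
      exact absurd he.symm (hf j' hj')
    · simp only [h1, h2, Function.update_self, ne_eq, not_false_eq_true,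
        Function.update_of_ne] at he
      exact absurd he (hf j hj)
    · simp only [h1, h2, ne_eq, not_false_eq_true, Function.update_of_ne] at he h0
      exact h.owner_inj j hj j' hj' he h0
  price_free j hj h0 := by
    by_cases h1 : j = b
    · simp [h1] at h0
    · simp only [h1, ne_eq, not_false_eq_true, Function.update_of_ne] at h0 ⊢
      exact h.price_free j hj h0
  slack j hj h0 k hk := by
    -- Prices only rise, so the right-hand side never gets worse; the object whose own price rises
    -- goes to a bidder for whom it was exactly optimal, and this uses up the slack of 1.
    have hle : p k ≤ Function.update p b (p b + 1) k := by
      by_cases h2 : k = b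
      · simp [h2]
      · simp [h2]
    by_cases h1 : j = b
    · subst h1
      have := hmin k hk
      simp only [Function.update_self, Nat.add_sub_cancel]
      omega
    · simp only [h1, ne_eq, not_false_eq_true, Function.update_of_ne] at h0 ⊢
      have := h.slack j hj h0 k hk
      omega
  price_le j hj := by
    by_cases h1 : j = b
    · subst h1
      -- A free object has price `0` and cost at most `C`. The best object is no dearer, so its
      -- price before the bid is at most `C`.
      obtain ⟨k, hk, h0⟩ := h.exists_free hi hf
      have h2 := hmin k hk
      rw [h.price_free k hk h0] at h2
      have h3 := hC i hi k hk
      simp only [Function.update_self]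
      omega
    · simpa [h1] using h.price_le j hj

theorem sum_update {b : ℕ} (hb : b < n) (p : ℕ → ℕ) :
    ∑ j ∈ Finset.range n, Function.update p b (p b + 1) j = ∑ j ∈ Finset.range n, p j + 1 := by
  rw [Finset.sum_update_of_mem (Finset.mem_range.2 hb), Finset.sdiff_singleton_eq_erase,
    ← Finset.add_sum_erase _ p (Finset.mem_range.2 hb)]
  omega

/-- A bid adds 1 to this sum, so the bound also limits the number of bids. -/
theorem sum_price_le (h : Auction n C c p o) : ∑ j ∈ Finset.range n, p j ≤ n * (C + 1) := by
  simpa using Finset.sum_le_sum fun j hj => h.price_le j (Finset.mem_range.1 hj)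

/-- Once every person holds an object, the total cost is within `n` of the optimum. -/
theorem exists_perm (h : Auction n C c p o) (ha : ∀ i < n, ∃ j < n, o j = i + 1) :
    ∃ π : Equiv.Perm (Fin n),
      ∑ j ∈ Finset.range n, c (o j - 1) j = ∑ i : Fin n, c i (π i) ∧
      ∀ σ : Equiv.Perm (Fin n), ∑ i : Fin n, c i (π i) ≤ ∑ i : Fin n, c i (σ i) + n := by
  choose f hf ho using ha
  have hinj : Function.Injective fun i : Fin n => (⟨f i i.2, hf i i.2⟩ : Fin n) := by
    intro a b hab
    have h1 : f a a.2 = f b b.2 := by simpa using hab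
    have h2 := ho a a.2
    have h3 := ho b b.2
    rw [h1] at h2
    ext; omega
  let π : Equiv.Perm (Fin n) := Equiv.ofBijective _ (Finite.injective_iff_bijective.1 hinj)
  have hπ : ∀ i : Fin n, o (π i) = i + 1 := fun i => ho i i.2
  refine ⟨π, ?_, fun σ => ?_⟩
  · rw [Finset.sum_range fun j => c (o j - 1) j, ← Equiv.sum_comp π]
    exact Finset.sum_congr rfl fun i _ => by rw [hπ]; simp
  · have h1 : ∀ i : Fin n, c i (π i) + p (π i) ≤ c i (σ i) + p (σ i) + 1 := fun i => by
      have := h.slack (π i) (π i).2 (by rw [hπ]; simp) (σ i) (σ i).2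
      rwa [hπ, Nat.add_sub_cancel] at this
    have h2 := Finset.sum_le_sum fun (i : Fin n) (_ : i ∈ Finset.univ) => h1 i
    simp only [Finset.sum_add_distrib] at h2
    -- Both permutations use every object once, so the prices cancel and only the `n` units of slack
    -- remain.
    rw [Equiv.sum_comp π fun i : Fin n => p i, Equiv.sum_comp σ fun i : Fin n => p i] at h2
    simp at h2
    omega

end Auction
end Discovery

/-! ### Programs for the bounds, the distances and the degrees. -/

namespace Discovery
open Cmd

/-- Computes, for `n` in register `0` and `b` in register `1`, the price `(n + 1) (n² + 1)` of an
inadmissible pair (register `4`) and the threshold `n + (n + 1) min b n²` (register `5`). -/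
def boundsCmd : Cmd :=
  .seq (.assign 2 (.const 0)) <|
  .seq (sumLoop 2 15 0 (.var 0)) <|
  .seq (.assign 3 (.sub (.var 1) (.sub (.var 1) (.var 2)))) <|
  .seq (.assign 4 (.const 0)) <|
  .seq (sumLoop 4 15 1 (.add (.var 2) (.const 1))) <|
  .seq (.assign 5 (.var 0)) (sumLoop 5 15 1 (.var 3))

/-- Products are repeated sums, and the minimum of `x` and `y` is the truncated difference `x - (x -
y)`. -/
theorem boundsCmd_den {n b : ℕ} {s : State} (hn : s.reg 0 = n) (hb : s.reg 1 = b) :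
    (boundsCmd.den s).reg 4 = (n + 1) * (n * n + 1) ∧
    (boundsCmd.den s).reg 5 = n + (n + 1) * min b (n * n) := by
  have hmin : b - (b - n * n) = min b (n * n) := by omega
  simp only [boundsCmd, den]
  set s1 := (sumLoop 2 15 0 (.var 0)).den (s.setReg 2 (Expr.eval s (.const 0))) with hs1
  have r2 : s1.reg 2 = n * n := by
    rw [hs1, sumLoop_den (fun _ => n) (n := n)] <;> simp [Expr.eval, hn]
    intro k _ s' hr _ _
    rw [hr 0] <;> simp [hn]
  have r0 : s1.reg 0 = n := by rw [hs1, den_reg _ rfl]; simpa using hn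
  have r1 : s1.reg 1 = b := by rw [hs1, den_reg _ rfl]; simpa using hb
  set s2 := s1.setReg 3 (Expr.eval s1 (.sub (.var 1) (.sub (.var 1) (.var 2)))) with hs2
  have q3 : s2.reg 3 = min b (n * n) := by simp [hs2, Expr.eval, r1, r2, hmin]
  have q2 : s2.reg 2 = n * n := by simp [hs2, r2]
  have q0 : s2.reg 0 = n := by simp [hs2, r0]
  set s3 := (sumLoop 4 15 1 (.add (.var 2) (.const 1))).den (s2.setReg 4 (Expr.eval s2 (.const 0)))
    with hs3
  have p4 : s3.reg 4 = (n + 1) * (n * n + 1) := by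
    rw [hs3, sumLoop_den (fun _ => n * n + 1) (n := n)] <;> simp [Expr.eval, q0]
    intro k _ s' hr _ _
    rw [hr 2] <;> simp [q2]
  have p3 : s3.reg 3 = min b (n * n) := by rw [hs3, den_reg _ rfl]; simpa using q3
  have p0 : s3.reg 0 = n := by rw [hs3, den_reg _ rfl]; simpa using q0
  constructor
  · rw [den_reg _ rfl]; simpa using p4
  · rw [sumLoop_den (fun _ => min b (n * n)) (n := n)] <;> simp [Expr.eval, p0]
    intro k _ s' hr _ _
    rw [hr 3] <;> simp [p3]

/-- Filling a square of an array. -/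
theorem forn_forn_put_den {a x y n : ℕ} {p : Cmd} {s : State} (f : ℕ → ℕ → ℕ)
    (hwf : (forn x 0 (forn y 0 p)).wf = true)
    (hn : s.reg 0 = n) (hxy : x ≠ y)
    (hp : ∀ i < n, ∀ j < n, ∀ s', Frame (forn x 0 (forn y 0 p)) s s' → s'.reg x = i →
      s'.reg y = j → (p.den s').mem a = (s'.setMem a i j (f i j)).mem a) :
    ∀ i < n, ∀ j < n, ((forn x 0 (forn y 0 p)).den s).mem a i j = f i j := by
  have hwf' := hwf
  simp only [wf, writesReg, Bool.and_eq_true, bne_iff_ne, Bool.not_eq_true', Bool.or_eq_false_iff,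
    beq_eq_false_iff_ne] at hwf'
  refine forn_induction (x := x) (c := 0) (p := forn y 0 p)
    (fun k s' => ∀ i < k, ∀ j < n, s'.mem a i j = f i j) hwf hn (by simp) ?_
  intro k s' hk hxk fr ih
  have h0 : s'.reg 0 = n := by
    rw [fr.1 0 (by simp [writesReg, hwf', Ne.symm hwf'.1.1.1]), hn]
  have key := forn_induction (x := y) (c := 0) (p := p) (s := s')
    (fun l s'' => (∀ i < k, ∀ j < n, s''.mem a i j = f i j) ∧
      ∀ j < l, s''.mem a k j = f k j) (by simp [wf, hwf']) h0 (by simpa using ih) ?_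
  · simp only [State.setReg_mem]
    intro i hi j hj
    rcases Nat.lt_succ_iff_lt_or_eq.1 hi with hi | rfl
    · exact key.1 i hi j hj
    · exact key.2 j hj
  · intro l s'' hl hyl fr' ih'
    have hpp := hp k hk l hl s'' ⟨fun z hz => ?_, fun b hb => ?_⟩ ?_ hyl
    · simp only [State.setReg_mem, hpp, State.setMem_mem]
      constructor
      · intro i hi j hj
        split_ifs with h
        · omega
        · exact ih'.1 i hi j hj
      · intro j hj
        split_ifs with h
        · rw [h.2.2]
        · exact ih'.2 j (by have : j ≠ l := fun e => h ⟨trivial, trivial, e⟩; omega)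
    · have h1 := fr.1 z hz
      simp only [writesReg, Bool.or_eq_false_iff] at hz
      rw [fr'.1 z (by simp only [writesReg, Bool.or_eq_false_iff]; exact hz.2), h1]
    · have h1 := fr.2 b hb
      rw [fr'.2 b hb, h1]
    · rw [fr'.1 x (by simp [writesReg, hxy, hwf']), hxk]

/-- Relaxation of the distance from register `16` to register `17` by a step from register `18`,
the length of an edge being `n + 1`. -/
def relaxCmd : Cmd :=
  .ite (.get 0 (.var 18) (.var 17))
    (.put 2 (.var 16) (.var 17) (.sub (.get 2 (.var 16) (.var 17)) (.sub (.get 2 (.var 16) (.var 17))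
      (.add (.get 2 (.var 16) (.var 18)) (.add (.var 0) (.const 1))))))
    .skip

/-- The entries of a table of distances belong to actual walks. -/
def Sound {n : ℕ} (G : SimpleGraph (Fin n)) (M : ℕ) (D : ℕ → ℕ → ℕ) : Prop :=
  ∀ i j : Fin n, D i j ≤ M ∧ (D i j = M ∨ ∃ d, WalkLe G d i j ∧ D i j = (n + 1) * d)

/-- The array `A₀` is the adjacency matrix of `G`. -/
def HasAdj {n : ℕ} (G : SimpleGraph (Fin n)) (s : State) : Prop :=
  s.reg 0 = n ∧ ∀ i j : Fin n, (G.Adj i j → s.mem 0 i j = 1) ∧ (¬ G.Adj i j → s.mem 0 i j = 0)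

theorem HasAdj.congr {n : ℕ} {G : SimpleGraph (Fin n)} {s s' : State} (h : HasAdj G s)
    (h0 : s'.reg 0 = s.reg 0) (hm : s'.mem 0 = s.mem 0) : HasAdj G s' := by
  rw [HasAdj, h0, hm]; exact h

variable {n : ℕ} {G : SimpleGraph (Fin n)} {M : ℕ} {s : State}

/-- The table is updated in place. Because entries never increase, an inequality gained by one
relaxation survives all later ones, and older, larger entries may stand on its right-hand side. -/
theorem relaxCmd_den (h : HasAdj G s) {i j z : Fin n} (hi : s.reg 16 = i) (hj : s.reg 17 = j)
    (hz : s.reg 18 = z) (hD : Sound G M (s.mem 2)) :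
    Sound G M ((relaxCmd.den s).mem 2) ∧ (∀ a b, (relaxCmd.den s).mem 2 a b ≤ s.mem 2 a b) ∧
      (G.Adj z j → (relaxCmd.den s).mem 2 i j ≤ s.mem 2 i z + (n + 1)) := by
  by_cases ha : G.Adj z j
  · have e : ∀ a b, (relaxCmd.den s).mem 2 a b =
        if a = i ∧ b = j then min (s.mem 2 i j) (s.mem 2 i z + (n + 1)) else s.mem 2 a b := by
      intro a b
      have : ∀ x y : ℕ, x - (x - y) = min x y := by omega
      simp [relaxCmd, den, Expr.eval, hi, hj, hz, (h.2 z j).1 ha, h.1, this]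
    refine ⟨fun a b => ?_, fun a b => ?_, fun _ => ?_⟩
    · rw [e]
      split_ifs with hab
      · obtain ⟨h1, h2⟩ := hab
        rw [Fin.ext h1, Fin.ext h2]
        refine ⟨(min_le_left _ _).trans (hD i j).1, ?_⟩
        rcases le_total (s.mem 2 i j) (s.mem 2 i z + (n + 1)) with hl | hl
        · rw [min_eq_left hl]; exact (hD i j).2
        · rw [min_eq_right hl]
          rcases (hD i z).2 with h3 | ⟨d, hd, h3⟩
          -- An infinite entry `M` is never propagated: adding an edge to it would exceed the bound
          -- `M` on `D i j`.
          · have := (hD i j).1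
            omega
          · exact .inr ⟨d + 1, hd.trans (.of_adj ha), by rw [h3, mul_add, mul_one]⟩
      · exact hD a b
    · rw [e]
      split_ifs with hab
      · rw [hab.1, hab.2]; exact min_le_left _ _
      · exact le_rfl
    · rw [e]
      simp
  · have e : relaxCmd.den s = s := by
      simp [relaxCmd, den, Expr.eval, hj, hz, (h.2 z j).2 ha]
    rw [e]
    exact ⟨hD, fun _ _ => le_rfl, fun h => absurd h ha⟩

theorem relaxCmd_loop₁ (h : HasAdj G s) {i j : Fin n} (hi : s.reg 16 = i) (hj : s.reg 17 = j)
    (hD : Sound G M (s.mem 2)) :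
    Sound G M (((forn 18 0 relaxCmd).den s).mem 2) ∧
      (∀ a b, ((forn 18 0 relaxCmd).den s).mem 2 a b ≤ s.mem 2 a b) ∧
      ∀ z : Fin n, G.Adj z j → ((forn 18 0 relaxCmd).den s).mem 2 i j ≤ s.mem 2 i z + (n + 1) := by
  have key := forn_induction (x := 18) (c := 0) (p := relaxCmd) (s := s) (fun k s' =>
    Sound G M (s'.mem 2) ∧ (∀ a b, s'.mem 2 a b ≤ s.mem 2 a b) ∧
      ∀ z : Fin n, z < k → G.Adj z j → s'.mem 2 i j ≤ s.mem 2 i z + (n + 1)) rfl h.1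
      (by simp [hD]) ?_
  · exact ⟨key.1, key.2.1, fun z => key.2.2 z z.2⟩
  · intro k s' hk hxk fr ih
    obtain ⟨h1, h2, h3⟩ := relaxCmd_den (h.congr (fr.1 0 rfl) (fr.2 0 rfl)) (i := i) (j := j)
      (z := ⟨k, hk⟩) (by rw [fr.1 16 rfl, hi]) (by rw [fr.1 17 rfl, hj]) hxk ih.1
    refine ⟨h1, fun a b => (h2 a b).trans (ih.2.1 a b), fun z hz hzj => ?_⟩
    rcases Nat.lt_succ_iff_lt_or_eq.1 hz with hz | hz
    · exact (h2 _ _).trans (ih.2.2 z hz hzj)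
    · obtain rfl : z = ⟨k, hk⟩ := Fin.ext hz
      exact (h3 hzj).trans (Nat.add_le_add_right (ih.2.1 _ _) _)

theorem relaxCmd_loop₂ (h : HasAdj G s) {i : Fin n} (hi : s.reg 16 = i)
    (hD : Sound G M (s.mem 2)) :
    Sound G M (((forn 17 0 (forn 18 0 relaxCmd)).den s).mem 2) ∧
      (∀ a b, ((forn 17 0 (forn 18 0 relaxCmd)).den s).mem 2 a b ≤ s.mem 2 a b) ∧
      ∀ j z : Fin n, G.Adj z j →
        ((forn 17 0 (forn 18 0 relaxCmd)).den s).mem 2 i j ≤ s.mem 2 i z + (n + 1) := by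
  have key := forn_induction (x := 17) (c := 0) (p := forn 18 0 relaxCmd) (s := s) (fun k s' =>
    Sound G M (s'.mem 2) ∧ (∀ a b, s'.mem 2 a b ≤ s.mem 2 a b) ∧
      ∀ j z : Fin n, j < k → G.Adj z j → s'.mem 2 i j ≤ s.mem 2 i z + (n + 1)) rfl h.1
      (by simp [hD]) ?_
  · exact ⟨key.1, key.2.1, fun j z => key.2.2 j z j.2⟩
  · intro k s' hk hxk fr ih
    obtain ⟨h1, h2, h3⟩ := relaxCmd_loop₁ (h.congr (fr.1 0 rfl) (fr.2 0 rfl)) (i := i)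
      (j := ⟨k, hk⟩) (by rw [fr.1 16 rfl, hi]) hxk ih.1
    refine ⟨h1, fun a b => (h2 a b).trans (ih.2.1 a b), fun j z hj hzj => ?_⟩
    rcases Nat.lt_succ_iff_lt_or_eq.1 hj with hj | hj
    · exact (h2 _ _).trans (ih.2.2 j z hj hzj)
    · obtain rfl : j = ⟨k, hk⟩ := Fin.ext hj
      exact (h3 z hzj).trans (Nat.add_le_add_right (ih.2.1 _ _) _)

/-- Relaxation of all distances. -/
def relaxAllCmd : Cmd := forn 16 0 (forn 17 0 (forn 18 0 relaxCmd))

theorem relaxAllCmd_den (h : HasAdj G s) (hD : Sound G M (s.mem 2)) :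
    Sound G M ((relaxAllCmd.den s).mem 2) ∧
      (∀ a b, (relaxAllCmd.den s).mem 2 a b ≤ s.mem 2 a b) ∧
      ∀ i j z : Fin n, G.Adj z j → (relaxAllCmd.den s).mem 2 i j ≤ s.mem 2 i z + (n + 1) := by
  have key := forn_induction (x := 16) (c := 0) (p := forn 17 0 (forn 18 0 relaxCmd)) (s := s)
    (fun k s' => Sound G M (s'.mem 2) ∧ (∀ a b, s'.mem 2 a b ≤ s.mem 2 a b) ∧
      ∀ i j z : Fin n, i < k → G.Adj z j → s'.mem 2 i j ≤ s.mem 2 i z + (n + 1)) rfl h.1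
      (by simp [hD]) ?_
  · exact ⟨key.1, key.2.1, fun i j z => key.2.2 i j z i.2⟩
  · intro k s' hk hxk fr ih
    obtain ⟨h1, h2, h3⟩ := relaxCmd_loop₂ (h.congr (fr.1 0 rfl) (fr.2 0 rfl)) (i := ⟨k, hk⟩)
      hxk ih.1
    refine ⟨h1, fun a b => (h2 a b).trans (ih.2.1 a b), fun i j z hi hzj => ?_⟩
    rcases Nat.lt_succ_iff_lt_or_eq.1 hi with hi | hi
    · exact (h2 _ _).trans (ih.2.2 i j z hi hzj)
    · obtain rfl : i = ⟨k, hk⟩ := Fin.ext hi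
      exact (h3 j z hzj).trans (Nat.add_le_add_right (ih.2.1 _ _) _)

/-- The expression that vanishes if and only if `e` and `f` have the same value. -/
def neExpr (e f : Expr) : Expr := .add (.sub e f) (.sub f e)

theorem neExpr_eval {e f : Expr} : (neExpr e f).eval s = 0 ↔ e.eval s = f.eval s := by
  simp only [neExpr, Expr.eval]; omega

/-- Computes in `A₂` the distances of the graph, in units of `n + 1`. -/
def distCmd : Cmd :=
  .seq (forn 15 0 (forn 16 0 (.ite (neExpr (.var 15) (.var 16))
    (.put 2 (.var 15) (.var 16) (.var 4)) (.put 2 (.var 15) (.var 16) (.const 0)))))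
    (forn 15 0 relaxAllCmd)

/-- Each pass over all triples accounts for one more edge, and `n` passes suffice because distances
are below `n`. Soundness gives the reverse inequality and keeps the initial value for vertices in
different components. -/
theorem distCmd_den (h : HasAdj G s) (h4 : s.reg 4 = (n + 1) * (n * n + 1)) (i j : Fin n) :
    (distCmd.den s).mem 2 i j = (n + 1) * cappedDist G i j := by
  simp only [distCmd, den.eq_4]
  set s1 := (forn 15 0 (forn 16 0 (.ite (neExpr (.var 15) (.var 16))
    (.put 2 (.var 15) (.var 16) (.var 4)) (.put 2 (.var 15) (.var 16) (.const 0))))).den s with hs1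
  have init : ∀ i < n, ∀ j < n, s1.mem 2 i j = if i = j then 0 else (n + 1) * (n * n + 1) := by
    refine forn_forn_put_den (fun i j => if i = j then 0 else (n + 1) * (n * n + 1)) rfl h.1
      (by decide) ?_
    intro i hi j hj s' fr hx hy
    have := fr.1 4 rfl
    by_cases hij : i = j
    · have := (neExpr_eval (s := s') (e := .var 15) (f := .var 16)).2 (by simp [Expr.eval, *])
      simp [den, this]
      simp [Expr.eval, *]
    · have := mt (neExpr_eval (s := s') (e := .var 15) (f := .var 16)).1 (by simp [Expr.eval, *])
      simp [den, this]
      simp [Expr.eval, *]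
  have hA : HasAdj G s1 := h.congr (den_reg _ rfl _) (den_mem _ rfl _)
  have key := forn_induction (x := 15) (c := 0) (p := relaxAllCmd) (s := s1)
    (fun k s' => Sound G ((n + 1) * (n * n + 1)) (s'.mem 2) ∧
      ∀ d ≤ k, ∀ i j : Fin n, WalkLe G d i j → s'.mem 2 i j ≤ (n + 1) * d) rfl hA.1 ?_ ?_
  · obtain ⟨hS, hC⟩ := key
    unfold cappedDist
    simp only [Fintype.card_fin]
    split_ifs with hr
    · have h1 := hC (G.dist i j) (by have := dist_lt_card hr; simp at this; omega) i j
        (walkLe_dist hr)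
      have h2 : G.dist i j ≤ n := by have := dist_lt_card hr; simp at this; omega
      rcases (hS i j).2 with h3 | ⟨d, ⟨p, hp⟩, h3⟩
      -- The initial value cannot persist for connected vertices: it would force `n * n + 1 ≤ G.dist
      -- i j ≤ n`.
      · rw [h3] at h1
        have := Nat.le_of_mul_le_mul_left h1 (by omega)
        nlinarith
      · refine le_antisymm h1 ?_
        rw [h3]
        exact Nat.mul_le_mul_left _ ((SimpleGraph.dist_le p).trans hp)
    · rcases (hS i j).2 with h3 | ⟨d, ⟨p, hp⟩, h3⟩
      · exact h3
      · exact absurd p.reachable hr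
  · simp only [State.setReg_mem]
    refine ⟨fun i j => ?_, ?_⟩
    · rw [init i i.2 j j.2]
      split_ifs with hij
      · exact ⟨Nat.zero_le _, .inr ⟨0, Fin.ext hij ▸ .refl _ _, rfl⟩⟩
      · exact ⟨le_rfl, .inl rfl⟩
    · intro d hd i j hw
      obtain rfl : d = 0 := by omega
      obtain ⟨p, hp⟩ := hw
      have := SimpleGraph.Walk.eq_of_length_eq_zero (by omega : p.length = 0)
      rw [init i i.2 j j.2, if_pos (by rw [this])]
      simp
  · intro k s' hk hxk fr ih
    obtain ⟨h1, h2, h3⟩ := relaxAllCmd_den (hA.congr (fr.1 0 rfl) (fr.2 0 rfl)) ih.1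
    refine ⟨h1, fun d hd i j hw => ?_⟩
    simp only [State.setReg_mem]
    cases d with
    | zero => exact (h2 _ _).trans (ih.2 0 (by omega) i j hw)
    | succ d =>
      rcases WalkLe.succ_iff.1 hw with rfl | ⟨z, hz, hzj⟩
      · exact (h2 _ _).trans ((ih.2 0 (by omega) i i (.refl _ _)).trans (by simp))
      · refine (h3 i j z hzj).trans ?_
        rw [mul_add, mul_one]
        exact Nat.add_le_add_right (ih.2 d (by omega) i z hz) _

/-- Computes the degrees in the first column of `A₃`. -/
def degCmd : Cmd :=
  forn 15 0 (.seq (.assign 7 (.const 0)) <| .seq (sumLoop 7 16 0 (.get 0 (.var 15) (.var 16)))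
    (.put 3 (.var 15) (.const 0) (.var 7)))

theorem deg_eq_sum (h : HasAdj G s) (i : Fin n) :
    deg G i = ∑ j ∈ Finset.range n, s.mem 0 i j := by
  classical
  rw [Finset.sum_range fun j => s.mem 0 i j, deg, Finset.card_filter]
  refine Finset.sum_congr rfl fun j _ => ?_
  split_ifs with hij
  · exact ((h.2 i j).1 hij).symm
  · exact ((h.2 i j).2 hij).symm

theorem degCmd_den (h : HasAdj G s) (i : Fin n) : (degCmd.den s).mem 3 i 0 = deg G i := by
  have key := forn_induction (x := 15) (c := 0) (s := s) (p := .seq (.assign 7 (.const 0)) <|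
    .seq (sumLoop 7 16 0 (.get 0 (.var 15) (.var 16))) (.put 3 (.var 15) (.const 0) (.var 7)))
    (fun k s' => ∀ i : Fin n, i < k → s'.mem 3 i 0 = deg G i) rfl h.1 (by simp) ?_
  · exact key i i.2
  · intro k s' hk hxk fr ih i hi
    have hs' : HasAdj G s' := h.congr (fr.1 0 rfl) (fr.2 0 rfl)
    simp only [den.eq_4, State.setReg_mem]
    simp only [den.eq_2, den.eq_3, State.setMem_mem, Expr.eval, true_and, and_true]
    rw [den_reg _ rfl, den_mem _ rfl, sumLoop_den (fun j => s.mem 0 k j) (n := n)]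
    · simp only [State.setReg_reg, State.setReg_mem, if_true, zero_add, add_zero]
      simp only [(by decide : (15 : ℕ) = 7 ↔ False), if_false, hxk]
      split_ifs with hik
      · rw [← hik, deg_eq_sum h]
      · exact ih i (by omega)
    · simpa using hs'.1
    · decide
    · decide
    · decide
    · intro l _ s'' hr hm hx
      simp only [Expr.eval, hx, hm, State.setReg_mem, fr.2 0 rfl]
      rw [hr 15 (by decide) (by decide)]
      simp [hxk]

end Discovery

/-! ### Programs for the auction. -/

namespace Discovery
open Cmd

variable {n : ℕ} {s : State}

/-- Finds in register `8` the best object for the person in register `19`, for costs in `A₇` and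
prices in `A₈`. -/
def bestCmd : Cmd :=
  .seq (.assign 8 (.const 0)) <|
  forn 20 0 <| .ite
    (.sub (.add (.get 7 (.var 19) (.var 8)) (.get 8 (.var 8) (.const 0)))
      (.add (.get 7 (.var 19) (.var 20)) (.get 8 (.var 20) (.const 0))))
    (.assign 8 (.var 20)) .skip

theorem bestCmd_den (hn : s.reg 0 = n) (h0 : 0 < n) {i : ℕ} (hi : s.reg 19 = i) :
    (bestCmd.den s).reg 8 < n ∧ ∀ k < n,
      s.mem 7 i ((bestCmd.den s).reg 8) + s.mem 8 ((bestCmd.den s).reg 8) 0 ≤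
        s.mem 7 i k + s.mem 8 k 0 := by
  refine forn_induction (x := 20) (c := 0) (s := s.setReg 8 0)
    (p := .ite (.sub (.add (.get 7 (.var 19) (.var 8)) (.get 8 (.var 8) (.const 0)))
      (.add (.get 7 (.var 19) (.var 20)) (.get 8 (.var 20) (.const 0))))
      (.assign 8 (.var 20)) .skip) (fun l s' => s'.reg 8 < n ∧ ∀ k < l,
      s.mem 7 i (s'.reg 8) + s.mem 8 (s'.reg 8) 0 ≤ s.mem 7 i k + s.mem 8 k 0)
    rfl (by simpa using hn) (by simpa using h0) ?_
  intro l s' hl hx fr ih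
  have m7 : s'.mem 7 = s.mem 7 := fr.2 7 rfl
  have m8 : s'.mem 8 = s.mem 8 := fr.2 8 rfl
  have r19 : s'.reg 19 = i := by rw [fr.1 19 rfl]; simpa using hi
  simp only [den, Expr.eval, m7, m8, r19, hx]
  split_ifs with h
  · simp only [State.setReg_reg]
    refine ⟨by simpa using hl, fun k hk => ?_⟩
    simp only [(by decide : (8 : ℕ) = 20 ↔ False), if_false, if_true]
    rcases Nat.lt_succ_iff_lt_or_eq.1 hk with hk | rfl
    · have := ih.2 k hk
      omega
    · exact le_rfl
  · simp only [State.setReg_reg]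
    simp only [(by decide : (8 : ℕ) = 20 ↔ False), if_false]
    refine ⟨ih.1, fun k hk => ?_⟩
    rcases Nat.lt_succ_iff_lt_or_eq.1 hk with hk | rfl
    · exact ih.2 k hk
    · omega

/-- Finds in register `9` whether the person in register `19` holds an object according to `A₉`. -/
def heldCmd : Cmd :=
  .seq (.assign 9 (.const 0)) <|
  sumLoop 9 20 0 (.sub (.const 1)
    (neExpr (.get 9 (.var 20) (.const 0)) (.add (.var 19) (.const 1))))

theorem heldCmd_den (hn : s.reg 0 = n) {i : ℕ} (hi : s.reg 19 = i) :
    (heldCmd.den s).reg 9 = 0 ↔ ∀ j < n, s.mem 9 j 0 ≠ i + 1 := by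
  simp only [heldCmd, den]
  rw [sumLoop_den (fun j => if s.mem 9 j 0 = i + 1 then 1 else 0) (n := n)]
  · simp [Expr.eval]
  · simpa using hn
  · decide
  · decide
  · decide
  · intro k hk s' hr hm hx
    have r19 : s'.reg 19 = i := by rw [hr 19 (by decide) (by decide)]; simpa using hi
    simp only [neExpr, Expr.eval, hm, r19, hx, State.setReg_mem]
    split_ifs <;> omega

/-- The person in register `19` bids, unless it holds an object. -/
def bidCmd : Cmd :=
  .seq heldCmd <| .ite (.var 9) .skip <|
  .seq bestCmd <|
  .seq (.put 8 (.var 8) (.const 0) (.add (.get 8 (.var 8) (.const 0)) (.const 1)))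
    (.put 9 (.var 8) (.const 0) (.add (.var 19) (.const 1)))

/-- An auction with costs in `A₇`, prices in `A₈` and owners in `A₉`. -/
def IsAuction (n C : ℕ) (s : State) : Prop :=
  s.reg 0 = n ∧ (∀ i < n, ∀ j < n, s.mem 7 i j ≤ C) ∧
    Auction n C (s.mem 7) (fun j => s.mem 8 j 0) fun j => s.mem 9 j 0

/-- The sum of the prices in an auction. -/
def priceSum (n : ℕ) (s : State) : ℕ := ∑ j ∈ Finset.range n, s.mem 8 j 0

/-- The person `i` holds an object. -/
def Holds (n : ℕ) (s : State) (i : ℕ) : Prop := ∃ j < n, s.mem 9 j 0 = i + 1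

variable {C : ℕ}

/-- The alternative measures progress: a person holding an object changes neither prices nor owners,
and any other person raises the total price by 1. -/
theorem bidCmd_den (h : IsAuction n C s) {i : ℕ} (hi : s.reg 19 = i) (hin : i < n) :
    IsAuction n C (bidCmd.den s) ∧
    (Holds n s i ∧ (bidCmd.den s).mem 8 = s.mem 8 ∧ (bidCmd.den s).mem 9 = s.mem 9 ∨
      ¬ Holds n s i ∧ priceSum n (bidCmd.den s) = priceSum n s + 1) := by
  have hr : (bidCmd.den s).reg 0 = n := by rw [den_reg _ rfl, h.1]
  have hm : (bidCmd.den s).mem 7 = s.mem 7 := by rw [den_mem _ rfl]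
  rw [IsAuction, hm]
  have hheld := heldCmd_den h.1 hi
  by_cases h9 : (heldCmd.den s).reg 9 = 0
  · have hh := hheld.1 h9
    have r19 : (heldCmd.den s).reg 19 = i := by rw [den_reg _ rfl, hi]
    have hb := bestCmd_den (s := heldCmd.den s) (n := n) (by rw [den_reg _ rfl, h.1]) (by omega)
      r19
    rw [den_mem (a := 7) heldCmd rfl, den_mem (a := 8) heldCmd rfl] at hb
    set b := (bestCmd.den (heldCmd.den s)).reg 8 with hbdef
    have e8 : (fun j => (bidCmd.den s).mem 8 j 0) =
        Function.update (fun j => s.mem 8 j 0) b (s.mem 8 b 0 + 1) := by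
      funext j
      simp only [bidCmd, den, Expr.eval, h9, ne_eq, not_true_eq_false, if_false, State.setMem_mem,
        ← hbdef, Function.update_apply]
      rw [den_mem _ rfl, den_mem _ rfl]
      simp
    have e9 : (fun j => (bidCmd.den s).mem 9 j 0) =
        Function.update (fun j => s.mem 9 j 0) b (i + 1) := by
      funext j
      simp only [bidCmd, den, Expr.eval, h9, ne_eq, not_true_eq_false, if_false, State.setMem_mem,
        ← hbdef, Function.update_apply, State.setMem_reg]
      rw [den_mem (a := 9) bestCmd rfl, den_mem (a := 9) heldCmd rfl, den_reg _ rfl, r19]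
      simp
    refine ⟨⟨hr, h.2.1, ?_⟩, .inr ⟨?_, ?_⟩⟩
    · rw [e8, e9]
      exact h.2.2.bid h.2.1 hin hh hb.1 hb.2
    · rintro ⟨j, hj, he⟩
      exact hh j hj he
    · have := Auction.sum_update hb.1 fun j => s.mem 8 j 0
      rw [← e8] at this
      exact this
  · have e : bidCmd.den s = heldCmd.den s := by simp [bidCmd, den, Expr.eval, h9]
    have e8 : (bidCmd.den s).mem 8 = s.mem 8 := by rw [e, den_mem _ rfl]
    have e9 : (bidCmd.den s).mem 9 = s.mem 9 := by rw [e, den_mem _ rfl]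
    rw [e8, e9]
    refine ⟨⟨hr, h.2⟩, .inl ⟨?_, rfl, rfl⟩⟩
    rw [hheld] at h9
    push Not at h9
    exact h9

/-- Every person may bid once. -/
def roundCmd : Cmd := forn 19 0 bidCmd

/-- An object changes hands only through a bid. So either the total price rises during the round, or
nobody bids and every person visited still holds an object at the end. -/
theorem roundCmd_den {r : ℕ} (h : IsAuction n C s)
    (hr : r ≤ priceSum n s ∨ ∀ i < n, Holds n s i) :
    IsAuction n C (roundCmd.den s) ∧
      (r + 1 ≤ priceSum n (roundCmd.den s) ∨ ∀ i < n, Holds n (roundCmd.den s) i) := by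
  refine forn_induction (x := 19) (c := 0) (s := s) (p := bidCmd) (fun k s' => IsAuction n C s' ∧
    (r + 1 ≤ priceSum n s' ∨ (r ≤ priceSum n s' ∨ ∀ i < n, Holds n s' i) ∧
      ∀ i < k, Holds n s' i)) rfl h.1 ?_ ?_ |>.imp id (Or.imp id And.right)
  · exact ⟨⟨by simpa using h.1, h.2⟩, .inr ⟨hr, by simp⟩⟩
  · intro k s' hk hx fr ih
    obtain ⟨h1, h2⟩ := bidCmd_den ih.1 hx hk
    refine ⟨⟨by simpa using h1.1, h1.2⟩, ?_⟩
    change r + 1 ≤ priceSum n (bidCmd.den s') ∨ (r ≤ priceSum n (bidCmd.den s') ∨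
      ∀ i < n, Holds n (bidCmd.den s') i) ∧ ∀ i < k + 1, Holds n (bidCmd.den s') i
    rcases h2 with ⟨hh, e8, e9⟩ | ⟨hh, e⟩
    · have e1 : priceSum n (bidCmd.den s') = priceSum n s' := by simp [priceSum, e8]
      have e2 : ∀ i, Holds n (bidCmd.den s') i ↔ Holds n s' i := by simp [Holds, e9]
      simp only [e1, e2]
      refine ih.2.imp id (And.imp id fun ha i hi => ?_)
      rcases Nat.lt_succ_iff_lt_or_eq.1 hi with hi | rfl
      · exact ha i hi
      · exact hh
    · left
      rw [e]
      rcases ih.2 with h3 | ⟨h3 | h3, -⟩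
      · omega
      · omega
      · exact absurd (h3 k hk) hh

/-- Repetition of a command that makes progress. -/
theorem repeat_den {x m : ℕ} {p : Cmd} (J : ℕ → State → Prop) (hwf : (forn x 1 p).wf = true)
    (hn : ∀ r s, J r s → s.reg 0 = n) (hx : ∀ r s v, J r s → J r (s.setReg x v))
    (hp : ∀ r s, J r s → J (r + m) (p.den s)) (r : ℕ) (s : State) (h : J r s) :
    J (r + (n + 1) * m) ((forn x 1 p).den s) := by
  refine forn_induction (x := x) (c := 1) (p := p) (s := s) (fun k s' => J (r + k * m) s')
    hwf (hn r s h) (by simpa using hx _ _ _ h) ?_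
  intro k s' _ _ _ ih
  have := hx _ _ (k + 1) (hp _ _ ih)
  rwa [add_assoc, ← Nat.succ_mul] at this

/-- `(n + 1) ^ 4` rounds. -/
def roundsCmd : Cmd := forn 15 1 (forn 16 1 (forn 17 1 (forn 18 1 roundCmd)))

/-- If somebody were still without an object, each of the `(n + 1) ^ 4` rounds would have raised the
total price, past its bound `n * (C + 1)` with `C = (n + 1) * (n * n + 1)`. -/
theorem roundsCmd_den (h : IsAuction n ((n + 1) * (n * n + 1)) s) :
    IsAuction n ((n + 1) * (n * n + 1)) (roundsCmd.den s) ∧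
      ∀ i < n, Holds n (roundsCmd.den s) i := by
  let J : ℕ → State → Prop := fun r s => IsAuction n ((n + 1) * (n * n + 1)) s ∧
    (r ≤ priceSum n s ∨ ∀ i < n, Holds n s i)
  have hn : ∀ r s, J r s → s.reg 0 = n := fun r s h => h.1.1
  have hx : ∀ x, x ≠ 0 → ∀ r s v, J r s → J r (s.setReg x v) := fun x hx r s v h =>
    ⟨⟨by simpa [Ne.symm hx] using h.1.1, h.1.2⟩, h.2⟩
  have h1 := repeat_den (x := 18) J rfl hn (hx 18 (by decide)) fun r s (h : J r s) =>
    (roundCmd_den h.1 h.2 : J (r + 1) _)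
  have h2 := repeat_den (x := 17) J rfl hn (hx 17 (by decide)) h1
  have h3 := repeat_den (x := 16) J rfl hn (hx 16 (by decide)) h2
  obtain ⟨h4, h5⟩ := repeat_den (x := 15) J rfl hn (hx 15 (by decide)) h3 0 s
    ⟨h, .inl (Nat.zero_le _)⟩
  refine ⟨h4, h5.resolve_left fun hle => ?_⟩
  have := hle.trans h4.2.2.sum_price_le
  nlinarith

/-- Empties the auction. -/
def resetCmd : Cmd :=
  .seq (forn 15 0 (.put 8 (.var 15) (.const 0) (.const 0)))
    (forn 15 0 (.put 9 (.var 15) (.const 0) (.const 0)))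

/-- Computes in register `10` a cost that exceeds the optimum by at most `n`. -/
def assignCmd : Cmd :=
  .seq resetCmd <| .seq roundsCmd <| .seq (.assign 10 (.const 0)) <|
  sumLoop 10 15 0 (.get 7 (.sub (.get 9 (.var 15) (.const 0)) (.const 1)) (.var 15))

theorem assignCmd_den (hn : s.reg 0 = n)
    (hC : ∀ i < n, ∀ j < n, s.mem 7 i j ≤ (n + 1) * (n * n + 1)) :
    ∃ π : Equiv.Perm (Fin n), (assignCmd.den s).reg 10 = ∑ i : Fin n, s.mem 7 i (π i) ∧
      ∀ σ : Equiv.Perm (Fin n),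
        ∑ i : Fin n, s.mem 7 i (π i) ≤ ∑ i : Fin n, s.mem 7 i (σ i) + n := by
  have ha : IsAuction n ((n + 1) * (n * n + 1)) (resetCmd.den s) := by
    have e7 : (resetCmd.den s).mem 7 = s.mem 7 := den_mem _ rfl _
    rw [IsAuction, e7]
    refine ⟨by rw [den_reg _ rfl, hn], hC, Auction.start.congr ?_ ?_⟩
    · intro j hj
      simp only [resetCmd, den.eq_4]
      rw [den_mem _ rfl]
      exact forn_put_den (fun _ => 0) hn (by decide) (fun _ _ _ _ _ _ => rfl) j hj
    · refine forn_put_den (fun _ => 0) ?_ (by decide) (fun _ _ _ _ _ _ => rfl)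
      rw [den_reg _ rfl, hn]
  obtain ⟨h1, h2⟩ := roundsCmd_den ha
  obtain ⟨π, h3, h4⟩ := h1.2.2.exists_perm h2
  have e7 : (roundsCmd.den (resetCmd.den s)).mem 7 = s.mem 7 := by
    rw [den_mem _ rfl, den_mem _ rfl]
  rw [e7] at h3 h4
  refine ⟨π, ?_, h4⟩
  rw [← h3]
  simp only [assignCmd, den.eq_4]
  rw [sumLoop_den (fun j => s.mem 7 ((roundsCmd.den (resetCmd.den s)).mem 9 j 0 - 1) j) (n := n)]
  · simp [den, Expr.eval]
  · simpa [den] using h1.1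
  · decide
  · decide
  · decide
  · intro k hk s' hr hm hx
    simp [Expr.eval, hm, hx, den, e7]

end Discovery

/-! ### The test for one choice of four vertices, and the search over all choices. -/

namespace Discovery
open Cmd

variable {n b : ℕ} {G : SimpleGraph (Fin n)} {S : Finset (Fin n)} {s : State}

/-- The state of the machine after its preparations. -/
structure Ready (G : SimpleGraph (Fin n)) (S : Finset (Fin n)) (b : ℕ) (s : State) : Prop where
  adj : HasAdj G s
  token : ∀ i : Fin n, s.mem 1 i 0 ≠ 0 ↔ i ∈ S
  dist : ∀ i j : Fin n, s.mem 2 i j = (n + 1) * cappedDist G i j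
  degree : ∀ i : Fin n, s.mem 3 i 0 = deg G i
  top : s.reg 4 = (n + 1) * (n * n + 1)
  threshold : s.reg 5 = n + (n + 1) * min b (n * n)

theorem Ready.congr {s' : State} (h : Ready G S b s) (h0 : s'.reg 0 = s.reg 0)
    (h4 : s'.reg 4 = s.reg 4) (h5 : s'.reg 5 = s.reg 5) (m0 : s'.mem 0 = s.mem 0)
    (m1 : s'.mem 1 = s.mem 1) (m2 : s'.mem 2 = s.mem 2) (m3 : s'.mem 3 = s.mem 3) :
    Ready G S b s' where
  adj := h.adj.congr h0 m0
  token := by rw [m1]; exact h.token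
  dist := by rw [m2]; exact h.dist
  degree := by rw [m3]; exact h.degree
  top := by rw [h4]; exact h.top
  threshold := by rw [h5]; exact h.threshold

/-- Registers `11`, …, `14` contain `t`, `k`, `u`, `v`. -/
def Choice (t k u v : Fin n) (s : State) : Prop :=
  s.reg 11 = t ∧ s.reg 12 = k ∧ s.reg 13 = u ∧ s.reg 14 = v

/-- Computes in `A₄` the vertices that are not adjacent to the one in register `11` and have at
most the degree in register `12`. -/
def candCmd : Cmd :=
  forn 15 0 (.put 4 (.var 15) (.const 0) (.sub (.sub (.const 1) (.get 0 (.var 11) (.var 15)))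
    (.sub (.get 3 (.var 15) (.const 0)) (.var 12))))

theorem candCmd_den (h : Ready G S b s) {t k u v : Fin n} (hc : Choice t k u v s) (i : Fin n) :
    (candCmd.den s).mem 4 i 0 = if i ∈ cand G t k then 1 else 0 := by
  -- The truncated difference is 1 exactly when the adjacency entry is 0 and the degree is at most
  -- `k`.
  have := forn_put_den (a := 4) (x := 15) (fun i => 1 - s.mem 0 t i - (s.mem 3 i 0 - k))
    h.adj.1 (by decide)
    (e := .sub (.sub (.const 1) (.get 0 (.var 11) (.var 15)))
      (.sub (.get 3 (.var 15) (.const 0)) (.var 12))) (by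
      intro l hl s' hr hm hx
      simp only [Expr.eval, hm 0 (by decide), hm 3 (by decide), hx, hr 11 (by decide),
        hr 12 (by decide), hc.1, hc.2.1]) i i.2
  rw [candCmd, this, h.degree]
  by_cases ha : G.Adj t i
  · rw [(h.adj.2 t i).1 ha, if_neg (by simp [mem_cand, ha])]
    omega
  · rw [(h.adj.2 t i).2 ha]
    split_ifs with hi
    · have := (mem_cand.1 hi).2
      omega
    · have : ¬ deg G i ≤ k := fun hd => hi (mem_cand.2 ⟨ha, hd⟩)
      omega

/-- Counts in register `7` the adjacent pairs of vertices in `A₄`. -/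
def conflictCmd : Cmd :=
  .seq (.assign 7 (.const 0)) <| forn 15 0 <| sumLoop 7 16 0
    (.sub (.add (.add (.get 4 (.var 15) (.const 0)) (.get 4 (.var 16) (.const 0)))
      (.get 0 (.var 15) (.var 16))) (.const 2))

/-- The sum of three indicators, less 2, is positive only if all three are 1, that is, for two
adjacent members of `X`. -/
theorem conflictCmd_den (h : HasAdj G s) {X : Finset (Fin n)}
    (hX : ∀ i : Fin n, s.mem 4 i 0 = if i ∈ X then 1 else 0) :
    (conflictCmd.den s).reg 7 = 0 ↔ G.IsIndepSet (X : Set (Fin n)) := by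
  have key : (conflictCmd.den s).reg 7 = 0 ↔ ∀ i < n, ∀ j < n,
      s.mem 4 i 0 + s.mem 4 j 0 + s.mem 0 i j - 2 = 0 := by
    simp only [conflictCmd, den.eq_4]
    refine forn_induction (x := 15) (c := 0) (s := (Cmd.assign 7 (.const 0)).den s)
      (fun k s' => s'.reg 7 = 0 ↔ ∀ i < k, ∀ j < n,
      s.mem 4 i 0 + s.mem 4 j 0 + s.mem 0 i j - 2 = 0) rfl (by simpa [den] using h.1)
      (by simp [den, Expr.eval]) ?_
    intro k s' hk hx fr ih
    have r0 : s'.reg 0 = n := by rw [fr.1 0 rfl]; simpa [den] using h.1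
    have m0 : s'.mem 0 = s.mem 0 := fr.2 0 rfl
    have m4 : s'.mem 4 = s.mem 4 := fr.2 4 rfl
    rw [State.setReg_reg, if_neg (by decide), sumLoop_den
      (fun j => s.mem 4 k 0 + s.mem 4 j 0 + s.mem 0 k j - 2) r0 (by decide) (by decide) (by decide)]
    · rw [Nat.add_eq_zero_iff, ih, Finset.sum_eq_zero_iff]
      simp only [Finset.mem_range, add_zero]
      constructor
      · rintro ⟨h1, h2⟩ i hi
        rcases Nat.lt_succ_iff_lt_or_eq.1 hi with hi | rfl
        · exact h1 i hi
        · exact h2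
      · exact fun h => ⟨fun i hi => h i (by omega), h k (by omega)⟩
    · intro l hl s'' hr hm hy
      simp only [Expr.eval, hm, m0, m4, hy, hr 15 (by decide) (by decide), hx]
  rw [key]
  constructor
  · intro hs i hi j hj _ ha
    have := hs i i.2 j j.2
    rw [hX, hX, (h.2 i j).1 ha, if_pos (by simpa using hi), if_pos (by simpa using hj)] at this
    omega
  · intro hi i hin j hjn
    lift i to Fin n using hin
    lift j to Fin n using hjn
    rw [hX, hX]
    by_cases ha : G.Adj i j
    · rw [(h.2 i j).1 ha]
      split_ifs with h1 h2
      · exact absurd ha (hi h1 h2 ha.ne)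
      all_goals rfl
    · rw [(h.2 i j).2 ha]
      split_ifs <;> rfl

/-- Computes in `A₇` the costs of pairs for the persons in `A₅` and the objects in `A₆`; if
register `7` is not zero, every pair is inadmissible. -/
def costCmd : Cmd :=
  forn 15 0 <| forn 16 0 <| .ite (.var 7) (.put 7 (.var 15) (.var 16) (.var 4)) <|
    .ite (.get 5 (.var 15) (.const 0))
      (.ite (.get 6 (.var 16) (.const 0))
        (.put 7 (.var 15) (.var 16) (.get 2 (.var 15) (.var 16)))
        (.put 7 (.var 15) (.var 16) (.var 4)))
      (.put 7 (.var 15) (.var 16) (.const 0))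

open Classical in
/-- The costs of pairs, all pairs being inadmissible unless `p` holds. -/
noncomputable def guardedCost (G : SimpleGraph (Fin n)) (p : Prop) (P O : Finset (Fin n))
    (i j : Fin n) : ℕ := if p then pairCost G P O i j else n * n + 1

theorem costCmd_den (h : Ready G S b s) {p : Prop} {P O : Finset (Fin n)}
    (hp : s.reg 7 = 0 ↔ p) (hP : ∀ i : Fin n, s.mem 5 i 0 ≠ 0 ↔ i ∈ P)
    (hO : ∀ i : Fin n, s.mem 6 i 0 ≠ 0 ↔ i ∈ O) (i j : Fin n) :
    (costCmd.den s).mem 7 i j = (n + 1) * guardedCost G p P O i j := by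
  have := forn_forn_put_den (a := 7) (x := 15) (y := 16) (fun i j =>
    if s.reg 7 ≠ 0 then s.reg 4 else if s.mem 5 i 0 ≠ 0 then
      if s.mem 6 j 0 ≠ 0 then s.mem 2 i j else s.reg 4 else 0)
    (p := .ite (.var 7) (.put 7 (.var 15) (.var 16) (.var 4)) <|
    .ite (.get 5 (.var 15) (.const 0))
      (.ite (.get 6 (.var 16) (.const 0))
        (.put 7 (.var 15) (.var 16) (.get 2 (.var 15) (.var 16)))
        (.put 7 (.var 15) (.var 16) (.var 4)))
      (.put 7 (.var 15) (.var 16) (.const 0))) rfl h.adj.1 (by decide) (by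
      intro i hi j hj s' fr hx hy
      simp only [den, Expr.eval, hx, hy, fr.1 7 rfl, fr.1 4 rfl, fr.2 5 rfl, fr.2 6 rfl,
        fr.2 2 rfl]
      split_ifs <;> rfl) i i.2 j j.2
  rw [costCmd, this]
  simp only [ne_eq, hp, hP, hO, ite_not, guardedCost, pairCost, h.top, h.dist, mul_ite, mul_zero,
    Fintype.card_fin]
  split_ifs <;> simp_all

/-- Sets register `6` if the cost in register `10` is below the threshold. -/
def checkCmd : Cmd := .ite (.sub (.var 10) (.var 5)) .skip (.assign 6 (.const 1))

/-- The part of `innerCmd` that follows the choice of persons and objects. -/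
def decideCmd : Cmd := .seq costCmd <| .seq assignCmd checkCmd

/-- All costs are multiples of `n + 1` and the computed total exceeds the optimum by at most `n`.
Hence comparing it with `n + (n + 1) * min b (n * n)` decides exactly whether some permutation meets
the capped budget. Failure of `p` makes all pairs inadmissible, so that the auction runs anyway and
rejects. -/
theorem decideCmd_den (h : Ready G S b s) (h0 : 0 < n) {p : Prop} {P O : Finset (Fin n)}
    (hp : s.reg 7 = 0 ↔ p) (hP : ∀ i : Fin n, s.mem 5 i 0 ≠ 0 ↔ i ∈ P)
    (hO : ∀ i : Fin n, s.mem 6 i 0 ≠ 0 ↔ i ∈ O) :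
    (decideCmd.den s).reg 6 ≠ 0 ↔ s.reg 6 ≠ 0 ∨ p ∧ Cover G O P b := by
  have hcost := costCmd_den h hp hP hO
  obtain ⟨π, h1, h2⟩ := assignCmd_den (s := costCmd.den s) (n := n)
    (by rw [den_reg _ rfl, h.adj.1]) (by
      intro i hi j hj
      lift i to Fin n using hi
      lift j to Fin n using hj
      rw [hcost]
      refine Nat.mul_le_mul_left _ ?_
      unfold guardedCost pairCost cappedDist
      split_ifs with _ _ _ hr
      · have := dist_lt_card hr
        simp only [Fintype.card_fin] at *
        nlinarith
      all_goals simp)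
  simp only [hcost, ← Finset.mul_sum] at h1 h2
  have r5 : (assignCmd.den (costCmd.den s)).reg 5 = n + (n + 1) * min b (n * n) := by
    rw [den_reg _ rfl, den_reg _ rfl, h.threshold]
  have r6 : (assignCmd.den (costCmd.den s)).reg 6 = s.reg 6 := by
    rw [den_reg _ rfl, den_reg _ rfl]
  have hcover : p ∧ Cover G O P b ↔
      ∃ σ : Equiv.Perm (Fin n), ∑ i, guardedCost G p P O i (σ i) ≤ min b (n * n) := by
    rw [cover_iff_exists_perm]
    simp only [Fintype.card_fin]
    by_cases hpp : p
    · simp [guardedCost, hpp]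
    · simp only [hpp, false_and, guardedCost, if_false, false_iff, not_exists, Finset.sum_const,
        Finset.card_univ, Fintype.card_fin, smul_eq_mul]
      -- The total `n * (n * n + 1)` exceeds the cap `n * n` because `n` is positive.
      intro _ hle
      have := hle.trans (min_le_right _ _)
      nlinarith
  have hle : (assignCmd.den (costCmd.den s)).reg 10 ≤ n + (n + 1) * min b (n * n) ↔
      ∃ σ : Equiv.Perm (Fin n), ∑ i, guardedCost G p P O i (σ i) ≤ min b (n * n) := by
    rw [h1]
    constructor
    · intro hl
      refine ⟨π, ?_⟩
      by_contra hcon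
      nlinarith
    · rintro ⟨σ, hσ⟩
      refine (h2 σ).trans ?_
      have := Nat.mul_le_mul_left (n + 1) hσ
      omega
  rw [hcover, ← hle]
  simp only [decideCmd, checkCmd, den, Expr.eval, r5]
  split_ifs with hd
  · rw [r6]
    have : ¬ (assignCmd.den (costCmd.den s)).reg 10 ≤ n + (n + 1) * min b (n * n) := by omega
    simp [this]
  · have : (assignCmd.den (costCmd.den s)).reg 10 ≤ n + (n + 1) * min b (n * n) := by omega
    simp [this]

/-- A choice of persons and objects, for a configuration and four vertices. -/
abbrev Selection := ∀ {n : ℕ}, SimpleGraph (Fin n) → Finset (Fin n) → Fin n → Fin n → Fin n →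
  Fin n → Finset (Fin n)

/-- The command `p` computes the persons `P` in `A₅` and the objects `O` in `A₆`. -/
structure Selects (p : Cmd) (P O : Selection) : Prop where
  wf : p.wf = true
  reg : ∀ y < 15, p.writesReg y = false
  mem : ∀ a < 5, p.writesMem a = false
  den : ∀ {n b : ℕ} {G : SimpleGraph (Fin n)} {S : Finset (Fin n)} {s : State} {t k u v : Fin n},
    Ready G S b s → Choice t k u v s →
    (∀ i : Fin n, s.mem 4 i 0 = if i ∈ cand G t k then 1 else 0) → ∀ i : Fin n,
    ((p.den s).mem 5 i 0 ≠ 0 ↔ i ∈ P G S t k u v) ∧ ((p.den s).mem 6 i 0 ≠ 0 ↔ i ∈ O G S t k u v)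

/-- The test for one choice of four vertices. -/
def innerCmd (p : Cmd) : Cmd := .seq candCmd <| .seq conflictCmd <| .seq p decideCmd

variable {p : Cmd} {P O : Selection}

/-- Registers below `6` hold the input and the prepared bounds, and `11` to `14` the four chosen
vertices; both must survive every test. -/
theorem innerCmd_writesReg (hp : Selects p P O) {y : ℕ} (hy : y < 15) (h7 : y < 6 ∨ 10 < y) :
    (innerCmd p).writesReg y = false := by
  have := hp.reg y hy
  have h1 : candCmd.writesReg y = false ∧ conflictCmd.writesReg y = false ∧
      decideCmd.writesReg y = false :=
    (by decide : ∀ y < 15, y < 6 ∨ 10 < y → candCmd.writesReg y = false ∧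
      conflictCmd.writesReg y = false ∧ decideCmd.writesReg y = false) y hy h7
  simp [innerCmd, writesReg, this, h1]

theorem innerCmd_writesMem (hp : Selects p P O) {a : ℕ} (ha : a < 4) :
    (innerCmd p).writesMem a = false := by
  have := hp.mem a (by omega)
  have h1 : candCmd.writesMem a = false ∧ conflictCmd.writesMem a = false ∧
      decideCmd.writesMem a = false :=
    (by decide : ∀ a < 4, candCmd.writesMem a = false ∧ conflictCmd.writesMem a = false ∧
      decideCmd.writesMem a = false) a ha
  simp [innerCmd, writesMem, this, h1]

theorem innerCmd_den (hp : Selects p P O) (h0 : 0 < n) (h : Ready G S b s) {t k u v : Fin n}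
    (hc : Choice t k u v s) :
    ((innerCmd p).den s).reg 6 ≠ 0 ↔ s.reg 6 ≠ 0 ∨ G.IsIndepSet (cand G t k : Set (Fin n)) ∧
      Cover G (O G S t k u v) (P G S t k u v) b := by
  have h1 := candCmd_den h hc
  have a1 : Ready G S b (candCmd.den s) := h.congr (den_reg _ rfl _) (den_reg _ rfl _)
    (den_reg _ rfl _) (den_mem _ rfl _) (den_mem _ rfl _) (den_mem _ rfl _) (den_mem _ rfl _)
  have h2 := conflictCmd_den a1.adj h1
  set s1 := candCmd.den s with hs1
  have a2 : Ready G S b (conflictCmd.den s1) := a1.congr (den_reg _ rfl _) (den_reg _ rfl _)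
    (den_reg _ rfl _) (den_mem _ rfl _) (den_mem _ rfl _) (den_mem _ rfl _) (den_mem _ rfl _)
  set s2 := conflictCmd.den s1 with hs2
  have c2 : Choice t k u v s2 := by
    simp only [Choice, hs2, hs1]
    simp only [den_reg conflictCmd (x := 11) rfl, den_reg candCmd (x := 11) rfl,
      den_reg conflictCmd (x := 12) rfl, den_reg candCmd (x := 12) rfl,
      den_reg conflictCmd (x := 13) rfl, den_reg candCmd (x := 13) rfl,
      den_reg conflictCmd (x := 14) rfl, den_reg candCmd (x := 14) rfl]
    exact hc
  have h3 := hp.den a2 c2 (by rw [hs2, den_mem _ rfl]; exact h1)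
  have a3 : Ready G S b (p.den s2) := a2.congr (den_reg _ (hp.reg _ (by decide)) _)
    (den_reg _ (hp.reg _ (by decide)) _) (den_reg _ (hp.reg _ (by decide)) _)
    (den_mem _ (hp.mem _ (by decide)) _) (den_mem _ (hp.mem _ (by decide)) _)
    (den_mem _ (hp.mem _ (by decide)) _) (den_mem _ (hp.mem _ (by decide)) _)
  have h4 := decideCmd_den a3 h0 (p := G.IsIndepSet (cand G t k : Set (Fin n)))
    (by rw [den_reg _ (hp.reg _ (by decide)), h2]) (fun i => (h3 i).1) (fun i => (h3 i).2)
  rw [den_reg p (hp.reg 6 (by decide)), hs2, den_reg conflictCmd rfl, hs1,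
    den_reg candCmd rfl] at h4
  exact h4

/-- A loop over the vertices that searches for one with the property `Q`. -/
theorem forn_exists {x : ℕ} {p : Cmd} {s : State} (Q : Fin n → Prop)
    (hwf : (forn x 0 p).wf = true) (hn : s.reg 0 = n) (hx : x ≠ 6)
    (hp : ∀ (k : Fin n) s', Frame (forn x 0 p) s s' → s'.reg x = k →
      ((p.den s').reg 6 ≠ 0 ↔ s'.reg 6 ≠ 0 ∨ Q k)) :
    ((forn x 0 p).den s).reg 6 ≠ 0 ↔ s.reg 6 ≠ 0 ∨ ∃ k, Q k := by
  have key := forn_induction (x := x) (c := 0) (p := p) (s := s)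
    (fun l s' => s'.reg 6 ≠ 0 ↔ s.reg 6 ≠ 0 ∨ ∃ k : Fin n, k < l ∧ Q k) hwf hn
    (by simp [Ne.symm hx]) ?_
  · rw [key]
    simp
  · intro l s' hl hxl fr ih
    rw [State.setReg_reg, if_neg (Ne.symm hx), hp ⟨l, hl⟩ s' fr hxl, ih, or_assoc]
    refine or_congr Iff.rfl ⟨?_, ?_⟩
    · rintro (⟨k, hk, hq⟩ | hq)
      · exact ⟨k, by omega, hq⟩
      · exact ⟨⟨l, hl⟩, by simp, hq⟩
    · rintro ⟨k, hk, hq⟩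
      rcases Nat.lt_succ_iff_lt_or_eq.1 hk with hk | hk
      · exact .inl ⟨k, hk, hq⟩
      · exact .inr ((Fin.ext hk : k = ⟨l, hl⟩) ▸ hq)

/-- The test for all choices of four vertices. -/
def searchCmd (p : Cmd) : Cmd := forn 11 0 (forn 12 0 (forn 13 0 (forn 14 0 (innerCmd p))))

end Discovery

/-! ### The whole procedure and its two instances. -/

namespace Discovery
open Cmd

variable {n b : ℕ} {G : SimpleGraph (Fin n)} {S : Finset (Fin n)} {s : State}
variable {p : Cmd} {P O : Selection}

theorem Ready.frame {q : Cmd} {s' : State} (h : Ready G S b s) (fr : Frame q s s')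
    (hr : ∀ y ∈ [0, 4, 5], q.writesReg y = false) (hm : ∀ a < 4, q.writesMem a = false) :
    Ready G S b s' :=
  h.congr (fr.1 _ (hr _ (by simp))) (fr.1 _ (hr _ (by simp))) (fr.1 _ (hr _ (by simp)))
    (fr.2 _ (hm _ (by simp))) (fr.2 _ (hm _ (by simp))) (fr.2 _ (hm _ (by simp)))
    (fr.2 _ (hm _ (by simp)))

theorem innerCmd_wf (hp : Selects p P O) : (innerCmd p).wf = true := by
  simp only [innerCmd, wf, hp.wf, Bool.and_eq_true]
  decide

theorem searchCmd_wf (hp : Selects p P O) : (searchCmd p).wf = true := by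
  simp [searchCmd, wf, writesReg, innerCmd_wf hp, innerCmd_writesReg hp]

theorem searchCmd_den (hp : Selects p P O) (h0 : 0 < n) (h : Ready G S b s) :
    ((searchCmd p).den s).reg 6 ≠ 0 ↔ s.reg 6 ≠ 0 ∨ ∃ t k u v : Fin n,
      G.IsIndepSet (cand G t k : Set (Fin n)) ∧
        Cover G (O G S t k u v) (P G S t k u v) b := by
  have hr := fun y hy h7 => innerCmd_writesReg hp (y := y) hy h7
  have hm := fun a ha => innerCmd_writesMem hp (a := a) ha
  have hwf := innerCmd_wf hp
  refine forn_exists _ (searchCmd_wf hp) h.adj.1 (by decide) fun t s₁ f₁ ht => ?_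
  have r₁ := h.frame f₁ (by simp [writesReg, hr]) fun a ha => by simp [writesMem, hm a ha]
  refine forn_exists _ (by simp [wf, writesReg, hwf, hr]) r₁.adj.1 (by decide)
    fun k s₂ f₂ hk => ?_
  have r₂ := r₁.frame f₂ (by simp [writesReg, hr]) fun a ha => by simp [writesMem, hm a ha]
  refine forn_exists _ (by simp [wf, writesReg, hwf, hr]) r₂.adj.1 (by decide)
    fun u s₃ f₃ hu => ?_
  have r₃ := r₂.frame f₃ (by simp [writesReg, hr]) fun a ha => by simp [writesMem, hm a ha]
  refine forn_exists _ (by simp [wf, hwf, hr]) r₃.adj.1 (by decide)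
    fun v s₄ f₄ hv => ?_
  have r₄ := r₃.frame f₄ (by simp [writesReg, hr]) fun a ha => by simp [writesMem, hm a ha]
  refine innerCmd_den hp h0 r₄ ⟨?_, ?_, ?_, hv⟩
  · rw [f₄.1 11 (by simp [writesReg, hr]), f₃.1 11 (by simp [writesReg, hr]),
      f₂.1 11 (by simp [writesReg, hr]), ht]
  · rw [f₄.1 12 (by simp [writesReg, hr]), f₃.1 12 (by simp [writesReg, hr]), hk]
  · rw [f₄.1 13 (by simp [writesReg, hr]), hu]

/-- The decision procedure; the answer is whether register `6` is not zero. -/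
def mainCmd (p : Cmd) : Cmd :=
  .seq boundsCmd <| .seq distCmd <| .seq degCmd <|
  .seq (.assign 6 (.sub (.const 1) (.var 0))) (searchCmd p)

theorem ready_prepared (G : SimpleGraph (Fin n)) (S : Finset (Fin n)) (b : ℕ) :
    Ready G S b (degCmd.den (distCmd.den (boundsCmd.den (input G S b)))) := by
  have a0 : HasAdj G (input G S b) := by
    refine ⟨rfl, fun i j => ?_⟩
    simp [input]
  obtain ⟨h4, h5⟩ := boundsCmd_den (s := input G S b) (n := n) (b := b) rfl rfl
  have a1 : HasAdj G (boundsCmd.den (input G S b)) := a0.congr (den_reg _ rfl _) (den_mem _ rfl _)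
  have a2 : HasAdj G (distCmd.den (boundsCmd.den (input G S b))) :=
    a1.congr (den_reg _ rfl _) (den_mem _ rfl _)
  refine ⟨a2.congr (den_reg _ rfl _) (den_mem _ rfl _), ?_, ?_, degCmd_den a2, ?_, ?_⟩
  · rw [den_mem _ rfl, den_mem _ rfl, den_mem _ rfl]
    simp [input]
  · rw [den_mem _ rfl]
    exact distCmd_den a1 h4
  · rw [den_reg _ rfl, den_reg _ rfl, h4]
  · rw [den_reg _ rfl, den_reg _ rfl, h5]

theorem mainCmd_den (hp : Selects p P O) (G : SimpleGraph (Fin n)) (S : Finset (Fin n)) (b : ℕ) :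
    ((mainCmd p).den (input G S b)).reg 6 ≠ 0 ↔ n = 0 ∨ ∃ t k u v : Fin n,
      G.IsIndepSet (cand G t k : Set (Fin n)) ∧
        Cover G (O G S t k u v) (P G S t k u v) b := by
  have hr := ready_prepared G S b
  simp only [mainCmd, den.eq_4]
  set s := degCmd.den (distCmd.den (boundsCmd.den (input G S b)))
  have e : (Cmd.assign 6 (.sub (.const 1) (.var 0))).den s = s.setReg 6 (1 - n) := by
    simp [den, Expr.eval, hr.adj.1]
  rw [e]
  have hr' : Ready G S b (s.setReg 6 (1 - n)) := by apply hr.congr <;> simp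
  -- The initial value `1 - n` of the flag answers yes for the graph without vertices, on which the
  -- search loops are never entered.
  rcases Nat.eq_zero_or_pos n with rfl | h0
  · simp only [true_or, iff_true]
    have := hr.adj.1
    simp [searchCmd, den, this]
  · rw [searchCmd_den hp h0 hr', State.setReg_reg, if_pos rfl]
    refine or_congr ?_ Iff.rfl
    omega

theorem solvableInPolyTimeOn_of_selects (hp : Selects p P O)
    {C : ∀ n : ℕ, SimpleGraph (Fin n) → Prop}
    {Q : ∀ n : ℕ, SimpleGraph (Fin n) → Finset (Fin n) → ℕ → Prop}
    (hQ : ∀ n G S b, C n G → (Q n G S b ↔ n = 0 ∨ ∃ t k u v : Fin n,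
      G.IsIndepSet (cand G t k : Set (Fin n)) ∧ Cover G (O G S t k u v) (P G S t k u v) b)) :
    SolvableInPolyTimeOn C Q := by
  -- Register `0` has to keep `n` until the loops are done, so the answer is moved there last; `1 -
  -- (1 - x)` turns any nonzero `x` into 1, and the assignment costs 6.
  refine ⟨.seq (mainCmd p).compile (.assign 0 (.sub (.const 1) (.sub (.const 1) (.var 6)))),
    (mainCmd p).time + .C 6, fun n G S b hG => ?_⟩
  obtain ⟨t, ht, he⟩ := (mainCmd p).exec
    (by simp only [mainCmd, wf, searchCmd_wf hp, Bool.and_eq_true]; decide)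
    (by
      have : (searchCmd p).writesReg 0 = false := by
        simp [searchCmd, writesReg, innerCmd_writesReg hp]
      simp only [mainCmd, writesReg, this, Bool.or_eq_false_iff]; decide) (input G S b)
  refine ⟨_, _, he.seq (.assign _ _ _), ?_, ?_, ?_⟩
  · have h0 : (input G S b).reg 0 = n := rfl
    rw [h0] at ht
    simpa [Expr.cost] using ht
  all_goals
    rw [hQ n G S b hG, ← mainCmd_den hp]
    intro h
    simp only [Expr.eval, State.setReg_reg, if_true]
    omega

/-- In Independent Set Discovery the tokens need partners among the candidates. -/
def tokensCmd : Cmd :=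
  .seq (forn 15 0 (.put 5 (.var 15) (.const 0) (.get 1 (.var 15) (.const 0))))
    (forn 15 0 (.put 6 (.var 15) (.const 0) (.get 4 (.var 15) (.const 0))))

theorem selects_tokensCmd :
    Selects tokensCmd (fun _ S _ _ _ _ => S) (fun G _ t k _ _ => cand G t k) where
  wf := rfl
  reg := by decide
  mem := by decide
  den {n b G S s t k u v} h hc hX i := by
    simp only [tokensCmd, den.eq_4]
    rw [den_mem (a := 5) (forn 15 0 (.put 6 _ _ _)) rfl]
    have h0 := h.adj.1
    rw [forn_put_den (fun i => s.mem 1 i 0) h0 (by decide) ?_ i i.2,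
      forn_put_den (fun i => s.mem 4 i 0) ?_ (by decide) ?_ i i.2]
    · rw [h.token, hX]
      simp
    · rw [den_reg _ rfl, h0]
    · intro l hl s' hr hm hx
      rw [Expr.eval, hm 4 (by decide), den_mem _ rfl]
      simp [Expr.eval, hx]
    · intro l hl s' hr hm hx
      simp [Expr.eval, hm 1 (by decide), hx]

/-- In Feedback Vertex Set Discovery the forced vertices need partners among the tokens. -/
def forcedCmd : Cmd :=
  .seq (forn 15 0 (.put 5 (.var 15) (.const 0) (.add
      (.sub (.const 1) (.add (.get 4 (.var 15) (.const 0))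
        (.add (.sub (.const 1) (neExpr (.var 15) (.var 13)))
          (.sub (.const 1) (neExpr (.var 15) (.var 14))))))
      (.sub (.sub (.add (.get 0 (.var 13) (.var 15)) (.get 0 (.var 14) (.var 15))) (.const 1))
        (.sub (.const 1) (neExpr (.var 13) (.var 14)))))))
    (forn 15 0 (.put 6 (.var 15) (.const 0) (.get 1 (.var 15) (.const 0))))

theorem selects_forcedCmd :
    Selects forcedCmd (fun G _ t k u v => forced G (cand G t k) u v) (fun _ S _ _ _ _ => S) where
  wf := rfl
  reg := by decide
  mem := by decide
  den {n b G S s t k u v} h hc hX i := by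
    simp only [forcedCmd, den.eq_4]
    rw [den_mem (a := 5) (forn 15 0 (.put 6 _ _ _)) rfl]
    have h0 := h.adj.1
    -- The sum of two indicators: the first says that `i` is neither a candidate nor `u` nor `v`,
    -- the second that `i` is a common neighbour of `u` and `v`, with `1 - ((u - v) + (v - u))`
    -- cancelling it when `u = v`.
    rw [forn_put_den (fun i => (1 - (s.mem 4 i 0 + ((1 - ((i - u) + (u - i))) +
        (1 - ((i - v) + (v - i)))))) + ((s.mem 0 u i + s.mem 0 v i - 1) -
        (1 - ((u - v) + (v - u))))) h0 (by decide) ?_ i i.2,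
      forn_put_den (fun i => s.mem 1 i 0) ?_ (by decide) ?_ i i.2]
    · rw [h.token]
      refine ⟨?_, Iff.rfl⟩
      rw [mem_forced, hX, Fin.ext_iff, Fin.ext_iff, ne_eq u v, Fin.ext_iff (a := u)]
      have hu := h.adj.2 u i
      have hv := h.adj.2 v i
      have e1 : (if i ∈ cand G t k then 1 else 0) = 0 ↔ i ∉ cand G t k := by simp
      have e2 : s.mem 0 u i + s.mem 0 v i - 1 = 1 ∧ (G.Adj u i ∧ G.Adj v i) ∨
          s.mem 0 u i + s.mem 0 v i - 1 = 0 ∧ ¬ (G.Adj u i ∧ G.Adj v i) := by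
        by_cases h2 : G.Adj u i <;> by_cases h3 : G.Adj v i <;> simp [h2, h3, hu, hv]
      generalize (if i ∈ cand G t k then 1 else 0) = x at *
      generalize s.mem 0 u i + s.mem 0 v i - 1 = y at *
      rcases e2 with ⟨rfl, e2⟩ | ⟨rfl, e2⟩ <;>
        by_cases h1 : i ∈ cand G t k <;> simp only [h1, e2, not_true, not_false_eq_true, iff_true,
          iff_false, true_or, false_or, and_true, and_false, or_false] at e1 ⊢ <;> omega
    · rw [den_reg _ rfl, h0]
    · intro l hl s' hr hm hx
      rw [Expr.eval, hm 1 (by decide), den_mem _ rfl]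
      simp [Expr.eval, hx]
    · intro l hl s' hr hm hx
      simp only [Expr.eval, neExpr, hm 4 (by decide), hm 0 (by decide), hx, hr 13 (by decide),
        hr 14 (by decide), hc.2.2.1, hc.2.2.2]

theorem isd_empty {G : SimpleGraph (Fin 0)} {S : Finset (Fin 0)} {b : ℕ} : ISD G S b :=
  ⟨S, fun v => v.elim0, 0, Nat.zero_le _, fun _ => S, rfl, rfl, fun _ h => absurd h (by simp)⟩

theorem fvsd_empty {G : SimpleGraph (Fin 0)} {S : Finset (Fin 0)} {b : ℕ} : FVSD G S b :=
  ⟨S, fun v => v.elim0, 0, Nat.zero_le _, fun _ => S, rfl, rfl, fun _ h => absurd h (by simp)⟩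

end Discovery

theorem corollary3 :
    Discovery.SolvableInPolyTimeOn (fun _ G => Discovery.IsSplit G)
        (fun _ G S b => Discovery.ISD G S b) ∧
      Discovery.SolvableInPolyTimeOn (fun _ G => Discovery.IsSplit G)
        (fun _ G S b => Discovery.FVSD G S b) := by
  constructor
  · refine Discovery.solvableInPolyTimeOn_of_selects Discovery.selects_tokensCmd
      fun n G S b hG => ?_
    rcases Nat.eq_zero_or_pos n with rfl | h0
    · simpa using Discovery.isd_empty
    have : Nonempty (Fin n) := ⟨⟨0, h0⟩⟩
    rw [Discovery.isd_iff hG, Fintype.card_fin]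
    constructor
    · rintro ⟨t, k, hk, h⟩
      -- The last two vertices play no role for independent sets; any values serve.
      exact .inr ⟨t, ⟨k, hk⟩, t, t, h⟩
    · rintro (rfl | ⟨t, k, _, _, h⟩)
      · omega
      · exact ⟨t, k, k.2, h⟩
  · refine Discovery.solvableInPolyTimeOn_of_selects Discovery.selects_forcedCmd
      fun n G S b hG => ?_
    rcases Nat.eq_zero_or_pos n with rfl | h0
    · simpa using Discovery.fvsd_empty
    have : Nonempty (Fin n) := ⟨⟨0, h0⟩⟩
    rw [Discovery.fvsd_iff hG, Fintype.card_fin]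
    constructor
    · rintro ⟨t, k, hk, hi, u, v, h⟩
      exact .inr ⟨t, ⟨k, hk⟩, u, v, hi, h⟩
    · rintro (rfl | ⟨t, k, u, v, hi, h⟩)
      · omega
      · exact ⟨t, k, k.2, hi, u, v, h⟩
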